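/- Let $D$ be the degenerate polynomial of oriented links, i.e. the unique invariant of oriented links with values in $\mathbb{C}[s,s^{-1}]$ such that $D(\bigcirc)=1$ for the unknot and $sD(L_{+})+s^{-1}D(L_{-})-2D(L_{0})=0$ for all oriented links $L_+,L_-,L_0$ that have diagrams differing only at one crossing, which is positive, negative, and smoothed, respectively. Let $n\ge 1$ and $k\ge 0$, let $x_1,\dots,x_{n-1}$ be the Artin generators of the braid group $\mathcal{B}_n$ (with the convention that the crossing of $x_i$ is negative), and for $\beta\in\mathcal{B}_n$ let $D_n(\beta)$ be the value of $D$ on the closure of $\beta$. Fix indices $i_1,\dots,i_k\in\{1,\dots,n-1\}$ and put $$e(\tau)=(1-s\tau)^2,\qquad E_0(\tau)=1-2s\tau,\qquad E_1(\tau)=\tau,$$ $$N(t_1,\dots,t_k)=\sum_{0\le j_1,\dots,j_k\le 1}E_{j_1}(t_1)\cdots E_{j_k}(t_k)\,D_n(x_{i_1}^{j_1}\cdots x_{i_k}^{j_k}).$$ Then the generating function of the polynomials $D_n(x_{i_1}^{a_1}\cdots x_{i_k}^{a_k})$ is a rational function in $t_1,\dots,t_k$: as formal power series over $\mathbb{C}[s,s^{-1}]$,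 $$\sum_{a\in\mathbb{N}^k}D_n(x_{i_1}^{a_1}\cdots x_{i_k}^{a_k})\,t_1^{a_1}\cdots t_k^{a_k}=e(t_1)^{-1}\cdots e(t_k)^{-1}\,N(t_1,\dots,t_k).$$ More generally, for every set $S\subseteq\{1,\dots,k\}$, the part of the formal series over $\mathbb{Z}^k$ in which the exponent $a_r$ is negative for $r\in S$ and nonnegative for $r\notin S$ satisfies $$e(t_1)\cdots e(t_k)\sum_{\substack{a\in\mathbb{Z}^k\\ a_r<0\,\Leftrightarrow\, r\in S}}D_n(x_{i_1}^{a_1}\cdots x_{i_k}^{a_k})\,t_1^{a_1}\cdots t_k^{a_k}=(-1)^{|S|}\,N(t_1,\dots,t_k).$$ -/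

import Mathlib

open scoped LaurentPolynomial
noncomputable section
namespace DegenerateLink

/-- The ring `ℂ[s, s⁻¹]` of Laurent polynomials in the variable `s`. -/
abbrev Coeff : Type := ℂ[T;T⁻¹]
/-- The variable `s`. -/
def s : Coeff := LaurentPolynomial.T 1
/-- The element `s⁻¹`. -/
def sInv : Coeff := LaurentPolynomial.T (-1)

theorem s_mul_sInv : s * sInv = 1 := by
  rw [s, sInv, ← LaurentPolynomial.T_add]; exact LaurentPolynomial.T_zero

/-- Artin's relators: far commutation and the braid relation. The index `j : Fin m` stands for the
generator of index `j + 1`. -/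
def braidRels (m : ℕ) : Set (FreeGroup (Fin m)) :=
  {r | ∃ i j : Fin m, i.val + 1 < j.val ∧
    r = FreeGroup.of i * FreeGroup.of j * (FreeGroup.of j * FreeGroup.of i)⁻¹} ∪
  {r | ∃ i j : Fin m, i.val + 1 = j.val ∧
    r = FreeGroup.of i * FreeGroup.of j * FreeGroup.of i *
      (FreeGroup.of j * FreeGroup.of i * FreeGroup.of j)⁻¹}

/-- The braid group on `m + 1` strands, with `m` Artin generators. So `BraidGroup m` is the group
usually written `B_n` with `n = m + 1 ≥ 1`. -/
abbrev BraidGroup (m : ℕ) : Type := PresentedGroup (braidRels m)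

/-- The Artin generators. In the diagram of `x_i` the crossing is negative. -/
def artin {m : ℕ} (i : Fin m) : BraidGroup m := PresentedGroup.of i

theorem artin_comm {m : ℕ} {i j : Fin m} (h : i.val + 1 < j.val) :
    artin i * artin j = artin j * artin i := by
  have := PresentedGroup.one_of_mem (rels := braidRels m) (Or.inl ⟨i, j, h, rfl⟩)
  rw [map_mul, map_inv, mul_inv_eq_one] at this
  rw [map_mul, map_mul] at this; exact this

theorem artin_braid {m : ℕ} {i j : Fin m} (h : i.val + 1 = j.val) :
    artin i * artin j * artin i = artin j * artin i * artin j := by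
  have := PresentedGroup.one_of_mem (rels := braidRels m) (Or.inr ⟨i, j, h, rfl⟩)
  rw [map_mul, map_inv, mul_inv_eq_one] at this
  simp only [map_mul] at this; exact this

/-- A map on the generators that respects the relations extends to the braid group. -/
def braidLift {m : ℕ} {G : Type} [Group G] (f : Fin m → G)
    (hc : ∀ i j : Fin m, i.val + 1 < j.val → f i * f j = f j * f i)
    (hb : ∀ i j : Fin m, i.val + 1 = j.val → f i * f j * f i = f j * f i * f j) :
    BraidGroup m →* G :=
  PresentedGroup.toGroup (f := f) (by
    rintro r (⟨i, j, h, rfl⟩ | ⟨i, j, h, rfl⟩)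
    · simp only [map_mul, map_inv, FreeGroup.lift_apply_of, mul_inv_eq_one]; exact hc i j h
    · simp only [map_mul, map_inv, FreeGroup.lift_apply_of, mul_inv_eq_one]; exact hb i j h)

theorem braidLift_artin {m : ℕ} {G : Type} [Group G] (f : Fin m → G) (hc hb) (i : Fin m) :
    braidLift f hc hb (artin i) = f i := PresentedGroup.toGroup.of ..

theorem braid_induction {m : ℕ} {p : BraidGroup m → Prop} (h1 : p 1)
    (hg : ∀ i, p (artin i)) (hmul : ∀ x y, p x → p y → p (x * y)) (hinv : ∀ x, p x → p x⁻¹)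
    (x : BraidGroup m) : p x := by
  have hx : x ∈ Subgroup.closure (Set.range (PresentedGroup.of (rels := braidRels m))) := by
    rw [PresentedGroup.closure_range_of]; trivial
  induction hx using Subgroup.closure_induction with
  | mem x h => obtain ⟨i, rfl⟩ := h; exact hg i
  | one => exact h1
  | mul x y _ _ hx hy => exact hmul x y hx hy
  | inv x _ hx => exact hinv x hx

/-- The inclusion of the braid group on `m + 1` strands into that on `m + 2` strands, adding a strand
on the right. -/
def braidIncl (m : ℕ) : BraidGroup m →* BraidGroup (m + 1) :=
  braidLift (fun i => artin i.castSucc) (fun _ _ h => artin_comm h) (fun _ _ h => artin_braid h)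

/-- The Markov moves between braids on any numbers of strands: conjugation, and positive and negative
stabilization. -/
inductive MarkovMove : (Σ m, BraidGroup m) → (Σ m, BraidGroup m) → Prop
  | conj (m : ℕ) (α β : BraidGroup m) : MarkovMove ⟨m, α * β⟩ ⟨m, β * α⟩
  | stab (m : ℕ) (β : BraidGroup m) :
      MarkovMove ⟨m, β⟩ ⟨m + 1, braidIncl m β * artin (Fin.last m)⟩
  | stab_inv (m : ℕ) (β : BraidGroup m) :
      MarkovMove ⟨m, β⟩ ⟨m + 1, braidIncl m β * (artin (Fin.last m))⁻¹⟩

/-- Oriented links up to isotopy, as braids (on any positive number of strands) up to Markov moves.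
By the theorems of Alexander and Markov, sending a braid to its closure is a bijection from these
classes onto the isotopy classes of oriented links. -/
def OrientedLink : Type := Quot MarkovMove

/-- The closure of a braid. -/
def braidClosure {m : ℕ} (β : BraidGroup m) : OrientedLink := Quot.mk _ ⟨m, β⟩

/-- The two axioms of the degenerate polynomial `D`: it is `1` on the unknot, and
`s D(L₊) + s⁻¹ D(L₋) - 2 D(L₀) = 0` for three links that differ at one crossing only. Such a triple
is the closure of `α x_i⁻¹ β`, `α x_i β`, `α β`, as `x_i` is a negative crossing. -/
structure IsDegeneratePolynomial (D : OrientedLink → Coeff) : Prop where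
  unknot : D (braidClosure (1 : BraidGroup 0)) = 1
  skein (m : ℕ) (α β : BraidGroup m) (i : Fin m) :
    s * D (braidClosure (α * (artin i)⁻¹ * β)) + sInv * D (braidClosure (α * artin i * β)) =
      2 * D (braidClosure (α * β))

/-- The relations of the Hecke algebra in which `(x - s)² = 0` for each generator `x`. -/
inductive HeckeRel (m : ℕ) : FreeAlgebra Coeff (Fin m) → FreeAlgebra Coeff (Fin m) → Prop
  | comm (i j : Fin m) : i.val + 1 < j.val → HeckeRel m
      (FreeAlgebra.ι Coeff i * FreeAlgebra.ι Coeff j) (FreeAlgebra.ι Coeff j * FreeAlgebra.ι Coeff i)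
  | braid (i j : Fin m) : i.val + 1 = j.val → HeckeRel m
      (FreeAlgebra.ι Coeff i * FreeAlgebra.ι Coeff j * FreeAlgebra.ι Coeff i)
      (FreeAlgebra.ι Coeff j * FreeAlgebra.ι Coeff i * FreeAlgebra.ι Coeff j)
  | quad (i : Fin m) : HeckeRel m
      (FreeAlgebra.ι Coeff i * FreeAlgebra.ι Coeff i)
      ((2 * s) • FreeAlgebra.ι Coeff i - (s ^ 2) • 1)

/-- The Hecke algebra on `m` generators, used below to show that `D` exists. -/
def Hecke (m : ℕ) : Type := RingQuot (HeckeRel m)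

instance (m : ℕ) : Ring (Hecke m) := inferInstanceAs (Ring (RingQuot (HeckeRel m)))
instance (m : ℕ) : Algebra Coeff (Hecke m) :=
  inferInstanceAs (Algebra Coeff (RingQuot (HeckeRel m)))

/-- The quotient map. -/
def heckeMk (m : ℕ) : FreeAlgebra Coeff (Fin m) →ₐ[Coeff] Hecke m :=
  RingQuot.mkAlgHom Coeff (HeckeRel m)

/-- The generators of the Hecke algebra. -/
def gen {m : ℕ} (i : Fin m) : Hecke m := heckeMk m (FreeAlgebra.ι Coeff i)

theorem gen_comm {m : ℕ} {i j : Fin m} (h : i.val + 1 < j.val) :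
    gen i * gen j = gen j * gen i := by
  have : heckeMk m _ = heckeMk m _ := RingQuot.mkAlgHom_rel Coeff (HeckeRel.comm i j h)
  simpa only [gen, map_mul] using this

theorem gen_braid {m : ℕ} {i j : Fin m} (h : i.val + 1 = j.val) :
    gen i * gen j * gen i = gen j * gen i * gen j := by
  have : heckeMk m _ = heckeMk m _ := RingQuot.mkAlgHom_rel Coeff (HeckeRel.braid i j h)
  simpa only [gen, map_mul] using this

theorem gen_sq {m : ℕ} (i : Fin m) :
    gen i * gen i = (2 * s) • gen i - (s ^ 2) • (1 : Hecke m) := by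
  have : heckeMk m _ = heckeMk m _ := RingQuot.mkAlgHom_rel Coeff (HeckeRel.quad i)
  simpa only [gen, map_mul, map_sub, map_smul, map_one] using this

theorem hecke_induction {m : ℕ} (S : Submodule Coeff (Hecke m)) (h1 : (1 : Hecke m) ∈ S)
    (hg : ∀ x ∈ S, ∀ i, x * gen i ∈ S) (x : Hecke m) : x ∈ S := by
  obtain ⟨a, rfl⟩ := RingQuot.mkAlgHom_surjective Coeff (HeckeRel m) x
  suffices H : ∀ y ∈ S, y * heckeMk m a ∈ S by
    have := H 1 h1; rwa [one_mul] at this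
  induction a using FreeAlgebra.induction with
  | grade0 r => intro y hy; simpa [Algebra.algebraMap_eq_smul_one] using S.smul_mem r hy
  | grade1 i => intro y hy; exact hg y hy i
  | mul a b ha hb => intro y hy; rw [map_mul, ← mul_assoc]; exact hb _ (ha _ hy)
  | add a b ha hb => intro y hy; rw [map_add, mul_add]; exact S.add_mem (ha _ hy) (hb _ hy)

/-- The universal property of the Hecke algebra. -/
def heckeLift {m : ℕ} {A : Type} [Ring A] [Algebra Coeff A] (f : Fin m → A)
    (hc : ∀ i j : Fin m, i.val + 1 < j.val → f i * f j = f j * f i)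
    (hb : ∀ i j : Fin m, i.val + 1 = j.val → f i * f j * f i = f j * f i * f j)
    (hq : ∀ i, f i * f i = (2 * s) • f i - (s ^ 2) • (1 : A)) : Hecke m →ₐ[Coeff] A :=
  RingQuot.liftAlgHom Coeff ⟨FreeAlgebra.lift Coeff f, by
    intro x y h
    induction h with
    | comm i j h => simpa using hc i j h
    | braid i j h => simpa using hb i j h
    | quad i => simpa using hq i⟩

theorem heckeLift_gen {m : ℕ} {A : Type} [Ring A] [Algebra Coeff A] (f : Fin m → A)
    (hc hb hq) (i : Fin m) : heckeLift f hc hb hq (gen i) = f i := by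
  exact (RingQuot.liftAlgHom_mkAlgHom_apply Coeff _ _ _).trans (by simp)

/-- The map of Hecke algebras that adds a generator. -/
def heckeIncl (m : ℕ) : Hecke m →ₐ[Coeff] Hecke (m + 1) :=
  heckeLift (fun i => gen i.castSucc) (fun _ _ h => gen_comm h) (fun _ _ h => gen_braid h)
    (fun i => gen_sq i.castSucc)

theorem heckeIncl_gen {m : ℕ} (i : Fin m) : heckeIncl m (gen i) = gen i.castSucc :=
  heckeLift_gen ..

/-- Right multiplication by a generator in the coordinates of `Hecke (m + 1)` over `Hecke m`. -/
def step (m : ℕ) (i : Fin (m + 1)) :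
    (Fin (m + 2) → Hecke m) →ₗ[Coeff] (Fin (m + 2) → Hecke m) where
  toFun v l :=
    if h : i.val + l.val < m then v l * gen ⟨i.val, by omega⟩
    else if h' : i.val + l.val = m then -(s ^ 2 • v ⟨l.val + 1, by omega⟩)
    else if h'' : i.val + l.val = m + 1 then v ⟨l.val - 1, by omega⟩ + (2 * s) • v l
    else v l * gen ⟨i.val - 1, by omega⟩
  map_add' v w := by
    ext l; dsimp only [Pi.add_apply]; split_ifs <;> simp only [add_mul, smul_add] <;> abel
  map_smul' c v := by
    ext l; dsimp only [Pi.smul_apply, RingHom.id_apply]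
    split_ifs <;> first | exact smul_mul_assoc .. | module

theorem step_apply (m : ℕ) (i : Fin (m + 1)) (v) (l : Fin (m + 2)) : step m i v l =
    if h : i.val + l.val < m then v l * gen ⟨i.val, by omega⟩
    else if h' : i.val + l.val = m then -(s ^ 2 • v ⟨l.val + 1, by omega⟩)
    else if h'' : i.val + l.val = m + 1 then v ⟨l.val - 1, by omega⟩ + (2 * s) • v l
    else v l * gen ⟨i.val - 1, by omega⟩ := rfl

theorem step_lt {m : ℕ} {i : Fin (m + 1)} {v} {l : Fin (m + 2)} (h : i.val + l.val < m) :
    step m i v l = v l * gen ⟨i.val, by omega⟩ := by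
  rw [step_apply, dif_pos h]
theorem step_eq {m : ℕ} {i : Fin (m + 1)} {v} {l : Fin (m + 2)} (h : i.val + l.val = m) :
    step m i v l = -(s ^ 2 • v ⟨l.val + 1, by omega⟩) := by
  rw [step_apply, dif_neg (by omega), dif_pos h]
theorem step_eq' {m : ℕ} {i : Fin (m + 1)} {v} {l : Fin (m + 2)} (h : i.val + l.val = m + 1) :
    step m i v l = v ⟨l.val - 1, by omega⟩ + (2 * s) • v l := by
  rw [step_apply, dif_neg (by omega), dif_neg (by omega), dif_pos h]
theorem step_gt {m : ℕ} {i : Fin (m + 1)} {v} {l : Fin (m + 2)} (h : m + 1 < i.val + l.val) :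
    step m i v l = v l * gen ⟨i.val - 1, by omega⟩ := by
  rw [step_apply, dif_neg (by omega), dif_neg (by omega), dif_neg (by omega)]

theorem step_sq (m : ℕ) (i : Fin (m + 1)) (v) :
    step m i (step m i v) = (2 * s) • step m i v - (s ^ 2) • v := by
  ext l
  rw [Pi.sub_apply, Pi.smul_apply, Pi.smul_apply]
  rcases lt_trichotomy (i.val + l.val) m with h | h | h
  · rw [step_lt h, step_lt h, mul_assoc, gen_sq]; simp [mul_sub]
  · have e : i.val + (⟨l.val + 1, by omega⟩ : Fin (m + 2)).val = m + 1 := by show i.val + (l.val + 1) = _; omega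
    rw [step_eq h, step_eq h, step_eq' e]
    simp only [Nat.add_sub_cancel]; module
  · rcases Nat.lt_or_ge (m + 1) (i.val + l.val) with h' | h'
    · rw [step_gt h', step_gt h', mul_assoc, gen_sq]; simp [mul_sub]
    · have h2 : i.val + l.val = m + 1 := by omega
      have e : i.val + (⟨l.val - 1, by omega⟩ : Fin (m + 2)).val = m := by show i.val + (l.val - 1) = _; omega
      rw [step_eq' h2, step_eq' h2, step_eq e]
      have : (⟨l.val - 1 + 1, by omega⟩ : Fin (m + 2)) = l := by ext; show l.val - 1 + 1 = _; omega
      simp only [this]; module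

theorem step_comm (m : ℕ) (i j : Fin (m + 1)) (hij : i.val + 1 < j.val) (v) :
    step m i (step m j v) = step m j (step m i v) := by
  ext l
  have c1 : ∀ a b : Fin m, a.val + 1 < b.val → ∀ x : Hecke m,
      x * gen b * gen a = x * gen a * gen b :=
    fun a b h x => by rw [mul_assoc, mul_assoc, gen_comm h]
  rcases lt_trichotomy (i.val + l.val) m with h | h | h
  · rw [step_lt h]
    rcases lt_trichotomy (j.val + l.val) m with h' | h' | h'
    · rw [step_lt h', step_lt h', step_lt h]
      exact c1 _ _ hij _
    · rw [step_eq h', step_eq h', step_lt (by show i.val + (l.val + 1) < m; omega)]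
      simp only [neg_mul, smul_mul_assoc]
    · rcases Nat.lt_or_ge (m + 1) (j.val + l.val) with h2 | h2
      · rw [step_gt h2, step_gt h2, step_lt h]
        exact c1 _ _ (by show i.val + 1 < j.val - 1; omega) _
      · have h3 : j.val + l.val = m + 1 := by omega
        rw [step_eq' h3, step_eq' h3, step_lt h,
          step_lt (by show i.val + (l.val - 1) < m; omega)]
        simp only [add_mul, smul_mul_assoc]
  · have h' : m + 1 < j.val + l.val := by omega
    rw [step_eq h, step_gt h', step_eq h,
      step_gt (by show m + 1 < j.val + (l.val + 1); omega)]
    simp only [neg_mul, smul_mul_assoc]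
  · have h' : m + 1 < j.val + l.val := by omega
    rcases Nat.lt_or_ge (m + 1) (i.val + l.val) with h2 | h2
    · rw [step_gt h2, step_gt h', step_gt h', step_gt h2]
      exact c1 _ _ (by show i.val - 1 + 1 < j.val - 1; omega) _
    · have h3 : i.val + l.val = m + 1 := by omega
      rw [step_eq' h3, step_gt h', step_gt h', step_eq' h3,
        step_gt (by show m + 1 < j.val + (l.val - 1); omega)]
      simp only [add_mul, smul_mul_assoc]

theorem step_braid (m : ℕ) (i j : Fin (m + 1)) (hij : i.val + 1 = j.val) (v) :
    step m i (step m j (step m i v)) = step m j (step m i (step m j v)) := by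
  ext l
  have c1 : ∀ a b : Fin m, a.val + 1 = b.val → ∀ x : Hecke m,
      x * gen a * gen b * gen a = x * gen b * gen a * gen b :=
    fun a b h x => by rw [mul_assoc, mul_assoc, ← mul_assoc (gen a), gen_braid h]; noncomm_ring
  rcases Nat.lt_or_ge (j.val + l.val) m with h | h
  · have h' : i.val + l.val < m := by omega
    rw [step_lt h', step_lt h, step_lt h', step_lt h, step_lt h', step_lt h]
    exact c1 _ _ hij _
  rcases Nat.lt_or_ge (m + 1) (i.val + l.val) with h' | h'
  · have h2 : m + 1 < j.val + l.val := by omega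
    rw [step_gt h', step_gt h2, step_gt h', step_gt h2, step_gt h', step_gt h2]
    exact c1 _ _ (by show i.val - 1 + 1 = j.val - 1; omega) _
  obtain ⟨p, hp⟩ : ∃ p, p + j.val = m := ⟨m - j.val, by omega⟩
  let l0 : Fin (m + 2) := ⟨p, by omega⟩
  let l1 : Fin (m + 2) := ⟨p + 1, by omega⟩
  let l2 : Fin (m + 2) := ⟨p + 2, by omega⟩
  let g : Hecke m := gen ⟨i.val, by omega⟩
  have i0 : ∀ w, step m i w l0 = w l0 * g := fun w =>
    step_lt (by show i.val + p < m; omega)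
  have i1 : ∀ w, step m i w l1 = -(s ^ 2 • w l2) := fun w =>
    step_eq (by show i.val + (p + 1) = m; omega)
  have i2 : ∀ w, step m i w l2 = w l1 + (2 * s) • w l2 := fun w =>
    step_eq' (by show i.val + (p + 2) = m + 1; omega)
  have j0 : ∀ w, step m j w l0 = -(s ^ 2 • w l1) := fun w =>
    step_eq (by show j.val + p = m; omega)
  have j1 : ∀ w, step m j w l1 = w l0 + (2 * s) • w l1 := fun w =>
    step_eq' (by show j.val + (p + 1) = m + 1; omega)
  have j2 : ∀ w, step m j w l2 = w l2 * g := fun w => by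
    rw [step_gt (by show m + 1 < j.val + (p + 2); omega)]
    congr 2; ext; show j.val - 1 = i.val; omega
  have hl : l = l0 ∨ l = l1 ∨ l = l2 := by
    simp only [Fin.ext_iff, l0, l1, l2]; omega
  have gg : g * g = (2 * s) • g - (s ^ 2) • (1 : Hecke m) := gen_sq _
  rcases hl with hl | hl | hl <;> rw [hl]
  · simp only [i0, i1, j0, j2, neg_mul, smul_mul_assoc]
  · simp only [i0, i1, i2, j0, j1, j2, neg_mul, smul_mul_assoc, add_mul]
    module
  · simp only [i0, i1, i2, j1, j2, smul_mul_assoc, add_mul, mul_assoc, gg, mul_sub,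
      mul_smul_comm, mul_one]
    module

/-- The right regular representation of `Hecke (m + 1)` in coordinates over `Hecke m`. -/
def heckeRho (m : ℕ) :
    Hecke (m + 1) →ₐ[Coeff] (Module.End Coeff (Fin (m + 2) → Hecke m))ᵐᵒᵖ :=
  heckeLift (fun i => MulOpposite.op (step m i))
    (fun i j h => by
      rw [← MulOpposite.op_mul, ← MulOpposite.op_mul]; congr 1
      exact LinearMap.ext fun v => (step_comm m i j h v).symm)
    (fun i j h => by
      simp only [← MulOpposite.op_mul]; congr 1
      exact LinearMap.ext fun v => step_braid m i j h v)
    (fun i => by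
      rw [← MulOpposite.op_mul, ← MulOpposite.op_smul, ← MulOpposite.op_one,
        ← MulOpposite.op_smul, ← MulOpposite.op_sub]; congr 1
      exact LinearMap.ext fun v => step_sq m i v)

/-- The coordinates of an element of `Hecke (m + 1)` over `Hecke m`. -/
def coords (m : ℕ) : Hecke (m + 1) →ₗ[Coeff] (Fin (m + 2) → Hecke m) where
  toFun h := (heckeRho m h).unop (Pi.single 0 1)
  map_add' x y := by rw [map_add, MulOpposite.unop_add, LinearMap.add_apply]
  map_smul' c x := by rw [map_smul, MulOpposite.unop_smul, LinearMap.smul_apply]; rfl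

theorem coords_one (m : ℕ) : coords m 1 = Pi.single 0 1 := by
  show (heckeRho m 1).unop (Pi.single 0 1) = _
  rw [map_one]; rfl

theorem coords_mul_gen (m : ℕ) (h : Hecke (m + 1)) (i : Fin (m + 1)) :
    coords m (h * gen i) = step m i (coords m h) := by
  show (heckeRho m (h * gen i)).unop (Pi.single 0 1) = _
  rw [map_mul, heckeRho, heckeLift_gen]; rfl

theorem step_mul (m : ℕ) (i : Fin (m + 1)) (a : Hecke m) (v) :
    step m i (fun l => a * v l) = fun l => a * step m i v l := by
  ext l
  simp only [step_apply]
  split_ifs <;> simp only [mul_assoc, mul_neg, mul_add, mul_smul_comm]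

theorem coords_incl (m : ℕ) (a : Hecke m) :
    coords m (heckeIncl m a) = fun l => a * (Pi.single 0 1 : Fin (m + 2) → Hecke m) l := by
  let f : Hecke m →ₗ[Coeff] (Fin (m + 2) → Hecke m) :=
    { toFun := fun a l => a * (Pi.single 0 1 : Fin (m + 2) → Hecke m) l
      map_add' := fun x y => by ext l; exact add_mul ..
      map_smul' := fun c x => by ext l; exact smul_mul_assoc .. }
  refine hecke_induction (LinearMap.eqLocus ((coords m).comp (heckeIncl m).toLinearMap) f) ?_ ?_ a
  · show coords m (heckeIncl m 1) = _
    rw [map_one, coords_one]; ext l; exact (one_mul _).symm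
  · intro x hx i
    have hx' : coords m (heckeIncl m x) = f x := hx
    show coords m (heckeIncl m (x * gen i)) = f (x * gen i)
    rw [map_mul, heckeIncl_gen, coords_mul_gen, hx', show f x = fun l => x * _ from rfl, step_mul]
    ext l
    show _ = x * gen i * _
    rw [mul_assoc]; congr 1
    refine Fin.cases ?_ (fun l => ?_) l
    · rw [step_lt (by show i.val + 0 < m; omega)]
      simp only [Pi.single_eq_same, one_mul, mul_one]; rfl
    · rw [step_apply]
      have : i.val < m := i.isLt
      split_ifs with h1 h2 h3
      · simp
      · rw [Pi.single_eq_of_ne (by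
          simp only [Fin.val_succ, ne_eq, Fin.ext_iff, Fin.val_zero]; omega)]
        simp
      · rw [Pi.single_eq_of_ne (by
          simp only [Fin.val_castSucc, Fin.val_succ, ne_eq, Fin.ext_iff, Fin.val_zero] at *; omega)]
        simp
      · simp

theorem coords_incl_mul (m : ℕ) (a : Hecke m) (h : Hecke (m + 1)) :
    coords m (heckeIncl m a * h) = fun l => a * coords m h l := by
  let f : Hecke (m + 1) →ₗ[Coeff] (Fin (m + 2) → Hecke m) :=
    { toFun := fun h l => a * coords m h l
      map_add' := fun x y => by ext l; rw [map_add]; exact mul_add ..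
      map_smul' := fun c x => by
        ext l; rw [map_smul]; exact mul_smul_comm c a (coords m x l) }
  refine hecke_induction (LinearMap.eqLocus
    ((coords m).comp (LinearMap.mulLeft Coeff (heckeIncl m a))) f) ?_ ?_ h
  · show coords m (heckeIncl m a * 1) = fun l => a * coords m 1 l
    rw [mul_one, coords_one, coords_incl]
  · intro x hx i
    have hx' : coords m (heckeIncl m a * x) = f x := hx
    show coords m (heckeIncl m a * (x * gen i)) = fun l => a * coords m (x * gen i) l
    rw [← mul_assoc, coords_mul_gen, hx', coords_mul_gen, ← step_mul]; rfl

/-- The product of the `k` last generators in descending order. -/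
def desc (m : ℕ) : ℕ → Hecke m
  | 0 => 1
  | k + 1 => if h : k < m then desc m k * gen ⟨m - 1 - k, by omega⟩ else 0

theorem desc_succ {m k : ℕ} (h : k < m) :
    desc m (k + 1) = desc m k * gen ⟨m - 1 - k, by omega⟩ := dif_pos h

theorem desc_incl (m : ℕ) (k : ℕ) (h : k ≤ m) :
    desc (m + 1) (k + 1) = gen (Fin.last m) * heckeIncl m (desc m k) := by
  induction k with
  | zero => rw [desc_succ (by omega), desc, desc, map_one, one_mul, mul_one]; rfl
  | succ k ih =>
    rw [desc_succ (by omega), ih (by omega), desc_succ (by omega), map_mul, heckeIncl_gen,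
      mul_assoc]
    congr 3; ext; show m + 1 - 1 - (k + 1) = m - 1 - k; omega

theorem desc_comm {m : ℕ} (k : ℕ) (i : Fin m) (h : i.val + k + 1 < m) :
    desc m k * gen i = gen i * desc m k := by
  induction k with
  | zero => rw [desc, one_mul, mul_one]
  | succ k ih =>
    rw [desc_succ (by omega), mul_assoc, ← gen_comm (by show i.val + 1 < m - 1 - k; omega),
      ← mul_assoc, ih (by omega), mul_assoc]

theorem desc_shift {m : ℕ} (k : ℕ) (hk : k ≤ m) (i : ℕ) (hi : i + 1 < m) (h : m < i + 1 + k) :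
    desc m k * gen ⟨i + 1, hi⟩ = gen ⟨i, by omega⟩ * desc m k := by
  induction k with
  | zero => omega
  | succ k ih =>
    rcases Nat.lt_or_ge m (i + 1 + k) with h' | h'
    · rw [desc_succ (by omega), mul_assoc,
        gen_comm (j := ⟨i + 1, hi⟩) (by show m - 1 - k + 1 < i + 1; omega), ← mul_assoc,
        ih (by omega) h', mul_assoc]
    · obtain ⟨k, rfl⟩ : ∃ k', k = k' + 1 := ⟨k - 1, by omega⟩
      have e1 : (⟨m - 1 - k, by omega⟩ : Fin m) = ⟨i + 1, hi⟩ := by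
        ext; show m - 1 - k = i + 1; omega
      have e2 : (⟨m - 1 - (k + 1), by omega⟩ : Fin m) = ⟨i, by omega⟩ := by
        ext; show m - 1 - (k + 1) = i; omega
      rw [desc_succ (by omega), desc_succ (by omega), e1, e2]
      have hb := gen_braid (i := (⟨i, by omega⟩ : Fin m)) (j := ⟨i + 1, hi⟩) rfl
      have hc := desc_comm k (⟨i, by omega⟩ : Fin m) (by show i + k + 1 < m; omega)
      simp only [mul_assoc] at hb ⊢
      rw [← hb, ← mul_assoc, hc, mul_assoc]

/-- The element with given coordinates. -/
def assemble (m : ℕ) : (Fin (m + 2) → Hecke m) →ₗ[Coeff] Hecke (m + 1) where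
  toFun v := ∑ l, heckeIncl m (v l) * desc (m + 1) l
  map_add' v w := by simp only [Pi.add_apply, map_add, add_mul, Finset.sum_add_distrib]
  map_smul' c v := by
    simp only [Pi.smul_apply, map_smul, smul_mul_assoc, Finset.smul_sum, RingHom.id_apply]

theorem step_single {m : ℕ} {i : Fin (m + 1)} {l : Fin (m + 2)} (h : i.val + l.val = m)
    (a : Hecke m) : step m i (Pi.single l a) = Pi.single ⟨l.val + 1, by omega⟩ a := by
  ext k
  rcases eq_or_ne k ⟨l.val + 1, by omega⟩ with rfl | hk
  · rw [step_eq' (by show i.val + (l.val + 1) = m + 1; omega), Pi.single_eq_same]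
    have h3 : (Pi.single l a : Fin (m + 2) → Hecke m) ⟨l.val + 1, by omega⟩ = 0 :=
      Pi.single_eq_of_ne (by simp only [ne_eq, Fin.ext_iff]; omega) _
    have h4 : (⟨l.val + 1 - 1, by omega⟩ : Fin (m + 2)) = l := rfl
    simp only [h3, h4, Pi.single_eq_same, smul_zero, add_zero]
  · rw [Pi.single_eq_of_ne hk, step_apply]
    simp only [ne_eq, Fin.ext_iff] at hk
    split_ifs with h1 h2 h3
    · rw [Pi.single_eq_of_ne (by simp only [ne_eq, Fin.ext_iff]; omega)]; simp
    · rw [Pi.single_eq_of_ne (by simp only [ne_eq, Fin.ext_iff]; omega)]; simp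
    · omega
    · rw [Pi.single_eq_of_ne (by simp only [ne_eq, Fin.ext_iff]; omega)]; simp

theorem assemble_single (m : ℕ) (l : Fin (m + 2)) (a : Hecke m) :
    assemble m (Pi.single l a) = heckeIncl m a * desc (m + 1) l := by
  show (∑ k : Fin (m + 2), heckeIncl m ((Pi.single l a : Fin (m + 2) → Hecke m) k) *
    desc (m + 1) k) = _
  rw [Finset.sum_eq_single l]
  · rw [Pi.single_eq_same]
  · intro b _ hb; rw [Pi.single_eq_of_ne hb, map_zero, zero_mul]
  · simp

theorem assemble_step (m : ℕ) (i : Fin (m + 1)) (v) :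
    assemble m (step m i v) = assemble m v * gen i := by
  suffices H : (assemble m).comp (step m i) =
      (LinearMap.mulRight Coeff (gen i)).comp (assemble m) from LinearMap.congr_fun H v
  refine LinearMap.pi_ext fun l a => ?_
  show assemble m (step m i (Pi.single l a)) = assemble m (Pi.single l a) * gen i
  rw [assemble_single]
  have hi := i.isLt
  have hl := l.isLt
  rcases lt_trichotomy (i.val + l.val) m with h | h | h
  · have e : step m i (Pi.single l a) = Pi.single l (a * gen ⟨i.val, by omega⟩) := by
      ext k
      rcases eq_or_ne k l with rfl | hk
      · rw [step_lt h, Pi.single_eq_same, Pi.single_eq_same]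
      · rw [Pi.single_eq_of_ne hk, step_apply, Pi.single_eq_of_ne hk]
        split_ifs with h1 h2 h3
        · simp
        · rw [Pi.single_eq_of_ne (by simp only [ne_eq, Fin.ext_iff]; omega)]; simp
        · rw [Pi.single_eq_of_ne (by simp only [ne_eq, Fin.ext_iff]; omega)]; simp
        · simp
    rw [e, assemble_single, map_mul, heckeIncl_gen, mul_assoc, mul_assoc,
      desc_comm l.val i (by omega)]; rfl
  · have e := step_single h a
    rw [e, assemble_single, mul_assoc]
    show _ * desc (m + 1) (l.val + 1) = _
    rw [desc_succ (by omega)]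
    congr 3; ext; show m + 1 - 1 - l.val = i.val; omega
  · rcases Nat.lt_or_ge (m + 1) (i.val + l.val) with h' | h'
    · have e : step m i (Pi.single l a) = Pi.single l (a * gen ⟨i.val - 1, by omega⟩) := by
        ext k
        rcases eq_or_ne k l with rfl | hk
        · rw [step_gt h', Pi.single_eq_same, Pi.single_eq_same]
        · rw [Pi.single_eq_of_ne hk, step_apply, Pi.single_eq_of_ne hk]
          split_ifs with h1 h2 h3
          · simp
          · rw [Pi.single_eq_of_ne (by simp only [ne_eq, Fin.ext_iff]; omega)]; simp
          · rw [Pi.single_eq_of_ne (by simp only [ne_eq, Fin.ext_iff]; omega)]; simp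
          · simp
      rw [e, assemble_single, map_mul, heckeIncl_gen, mul_assoc, mul_assoc]
      have := desc_shift (m := m + 1) l.val (by omega) (i.val - 1) (by omega) (by omega)
      have e2 : (⟨i.val - 1 + 1, by omega⟩ : Fin (m + 1)) = i := by
        ext; show i.val - 1 + 1 = i.val; omega
      rw [e2] at this
      rw [this]; rfl
    · have h2 : i.val + l.val = m + 1 := by omega
      have e : step m i (Pi.single l a) =
          Pi.single l ((2 * s) • a) - Pi.single ⟨l.val - 1, by omega⟩ (s ^ 2 • a) := by
        ext k
        rw [Pi.sub_apply]
        rcases eq_or_ne k l with rfl | hk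
        · rw [step_eq' h2, Pi.single_eq_same, Pi.single_eq_same,
            Pi.single_eq_of_ne (by simp only [ne_eq, Fin.ext_iff]; omega),
            Pi.single_eq_of_ne (by simp only [ne_eq, Fin.ext_iff]; omega)]
          simp
        · rw [Pi.single_eq_of_ne hk]
          rcases eq_or_ne k ⟨l.val - 1, by omega⟩ with rfl | hk'
          · rw [step_eq (by show i.val + (l.val - 1) = m; omega), Pi.single_eq_same]
            have : (⟨l.val - 1 + 1, by omega⟩ : Fin (m + 2)) = l := by
              ext; show l.val - 1 + 1 = l.val; omega
            simp only [this, Pi.single_eq_same, zero_sub]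
          · rw [Pi.single_eq_of_ne hk', step_apply, Pi.single_eq_of_ne hk]
            simp only [ne_eq, Fin.ext_iff] at hk hk'
            split_ifs with h1 h2 h3
            · simp
            · rw [Pi.single_eq_of_ne (by simp only [ne_eq, Fin.ext_iff]; omega)]; simp
            · omega
            · simp
      rw [e, map_sub, assemble_single, assemble_single, mul_assoc]
      obtain ⟨p, hp⟩ : ∃ p, l.val = p + 1 := ⟨l.val - 1, by omega⟩
      have e3 : (⟨m + 1 - 1 - p, by omega⟩ : Fin (m + 1)) = i := by
        ext; show m + 1 - 1 - p = i.val; omega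
      simp only [hp, Nat.add_sub_cancel]
      rw [desc_succ (by omega), e3, mul_assoc, gen_sq]
      simp only [map_smul, mul_sub, mul_smul_comm, smul_mul_assoc, mul_one]

theorem assemble_coords (m : ℕ) (h : Hecke (m + 1)) : assemble m (coords m h) = h := by
  refine hecke_induction (LinearMap.eqLocus ((assemble m).comp (coords m)) LinearMap.id) ?_ ?_ h
  · show assemble m (coords m 1) = 1
    rw [coords_one, assemble_single, map_one, one_mul]; rfl
  · intro x hx i
    have hx' : assemble m (coords m x) = x := hx
    show assemble m (coords m (x * gen i)) = x * gen i
    rw [coords_mul_gen, assemble_step, hx']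


theorem coords_desc (m k : ℕ) (h : k ≤ m + 1) :
    coords m (desc (m + 1) k) = Pi.single ⟨k, by omega⟩ 1 := by
  induction k with
  | zero => rw [desc, coords_one]; rfl
  | succ k ih =>
    rw [desc_succ (by omega), coords_mul_gen, ih (by omega),
      step_single (by show m + 1 - 1 - k + k = m; omega)]

theorem hecke_span_induction {m : ℕ} (S : Submodule Coeff (Hecke (m + 1)))
    (h0 : ∀ a, heckeIncl m a ∈ S)
    (h1 : ∀ a b, heckeIncl m a * gen (Fin.last m) * heckeIncl m b ∈ S) (h : Hecke (m + 1)) :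
    h ∈ S := by
  rw [← assemble_coords m h]
  show (∑ l : Fin (m + 2), heckeIncl m (coords m h l) * desc (m + 1) l) ∈ S
  refine S.sum_mem fun l _ => ?_
  refine Fin.cases ?_ (fun l => ?_) l
  · have := h0 (coords m h 0)
    rwa [← mul_one (heckeIncl m (coords m h 0))] at this
  · rw [Fin.val_succ, desc_incl m l.val (by omega), ← mul_assoc]
    exact h1 _ _

theorem hecke_zero (h : Hecke 0) : ∃ c : Coeff, h = c • 1 := by
  have := hecke_induction (Submodule.span Coeff {(1 : Hecke 0)})
    (Submodule.mem_span_singleton_self _) (fun _ _ i => i.elim0) h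
  obtain ⟨c, hc⟩ := Submodule.mem_span_singleton.1 this
  exact ⟨c, hc.symm⟩

theorem hecke_incl_incl_comm {m : ℕ} (y : Hecke m) :
    heckeIncl (m + 1) (heckeIncl m y) * gen (Fin.last (m + 1)) =
      gen (Fin.last (m + 1)) * heckeIncl (m + 1) (heckeIncl m y) := by
  let f : Hecke m →ₗ[Coeff] Hecke (m + 2) :=
    ((heckeIncl (m + 1)).comp (heckeIncl m)).toLinearMap
  refine hecke_induction (LinearMap.eqLocus
    ((LinearMap.mulRight Coeff (gen (Fin.last (m + 1)))).comp f)
    ((LinearMap.mulLeft Coeff (gen (Fin.last (m + 1)))).comp f)) ?_ ?_ y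
  · show heckeIncl (m + 1) (heckeIncl m 1) * _ = _ * heckeIncl (m + 1) (heckeIncl m 1)
    simp only [map_one, one_mul, mul_one]
  · intro x hx i
    have hx' : heckeIncl (m + 1) (heckeIncl m x) * gen (Fin.last (m + 1)) =
      gen (Fin.last (m + 1)) * heckeIncl (m + 1) (heckeIncl m x) := hx
    show heckeIncl (m + 1) (heckeIncl m (x * gen i)) * gen (Fin.last (m + 1)) =
      gen (Fin.last (m + 1)) * heckeIncl (m + 1) (heckeIncl m (x * gen i))
    rw [map_mul, map_mul, heckeIncl_gen, heckeIncl_gen, mul_assoc,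
      gen_comm (i := i.castSucc.castSucc) (j := Fin.last (m + 1))
        (by show i.val + 1 < m + 1; omega), ← mul_assoc, hx', mul_assoc]

/-- The value `(s + s⁻¹) / 2` of `D` on the unlink with two components. -/
def delta : Coeff := LaurentPolynomial.C (1 / 2) * (s + sInv)

theorem two_mul_half : (2 : Coeff) * LaurentPolynomial.C (1 / 2) = 1 := by
  rw [show (2 : Coeff) = LaurentPolynomial.C 2 from (map_ofNat LaurentPolynomial.C 2).symm,
    ← map_mul]
  norm_num

theorem two_mul_delta : 2 * delta = s + sInv := by
  rw [delta, ← mul_assoc, two_mul_half, one_mul]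

/-- Ocneanu's trace on the Hecke algebra. -/
def markovTrace : (m : ℕ) → Hecke m →ₗ[Coeff] Coeff
  | 0 => (heckeLift (A := Coeff) (fun i : Fin 0 => i.elim0) (fun i => i.elim0)
      (fun i => i.elim0) (fun i => i.elim0)).toLinearMap
  | m + 1 =>
    { toFun := fun h => delta * markovTrace m (coords m h 0) +
        ∑ l : Fin (m + 1), markovTrace m (coords m h l.succ * desc m l.val)
      map_add' := fun x y => by
        simp only [map_add, Pi.add_apply, add_mul, mul_add, Finset.sum_add_distrib]; abel
      map_smul' := fun c x => by
        simp only [map_smul, Pi.smul_apply, smul_mul_assoc, smul_eq_mul, ← Finset.mul_sum,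
          RingHom.id_apply]; ring }

theorem markovTrace_zero_one : markovTrace 0 1 = 1 := map_one (heckeLift (A := Coeff) _ _ _ _)

theorem markovTrace_succ (m : ℕ) (h : Hecke (m + 1)) : markovTrace (m + 1) h =
    delta * markovTrace m (coords m h 0) +
      ∑ l : Fin (m + 1), markovTrace m (coords m h l.succ * desc m l.val) := rfl

theorem markovTrace_incl (m : ℕ) (a : Hecke m) :
    markovTrace (m + 1) (heckeIncl m a) = delta * markovTrace m a := by
  rw [markovTrace_succ, coords_incl, Finset.sum_eq_zero, add_zero]
  · beta_reduce
    rw [Pi.single_eq_same, mul_one]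
  intro l _
  beta_reduce
  rw [Pi.single_eq_of_ne (Fin.succ_ne_zero l), mul_zero, zero_mul, map_zero]

theorem markovTrace_desc (m : ℕ) (a : Hecke m) (k : ℕ) (hk : k ≤ m) :
    markovTrace (m + 1) (heckeIncl m a * desc (m + 1) (k + 1)) = markovTrace m (a * desc m k) := by
  rw [markovTrace_succ, coords_incl_mul, coords_desc m (k + 1) (by omega),
    Finset.sum_eq_single ⟨k, by omega⟩]
  · beta_reduce
    rw [Pi.single_eq_of_ne (i := (⟨k + 1, by omega⟩ : Fin (m + 2))) (i' := 0)
      (by simp only [ne_eq, Fin.ext_iff, Fin.val_zero]; omega)]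
    rw [show (Fin.succ ⟨k, by omega⟩ : Fin (m + 2)) = ⟨k + 1, by omega⟩ from rfl,
      Pi.single_eq_same, mul_one, mul_zero, map_zero, mul_zero, zero_add]
  · intro l _ hl
    beta_reduce
    rw [Pi.single_eq_of_ne (by
      simp only [ne_eq, Fin.ext_iff, Fin.val_succ] at *; omega), mul_zero, zero_mul, map_zero]
  · simp

theorem markovTrace_mark (m : ℕ) (a b : Hecke m) :
    markovTrace (m + 1) (heckeIncl m a * gen (Fin.last m) * heckeIncl m b) =
      markovTrace m (a * b) := by
  cases m with
  | zero =>
    obtain ⟨c, rfl⟩ := hecke_zero b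
    have := markovTrace_desc 0 a 0 le_rfl
    rw [desc_incl 0 0 le_rfl] at this
    simp only [desc, map_one, mul_one] at this
    simp only [map_smul, map_one, mul_smul_comm, mul_one, this]
  | succ m =>
    conv_lhs => rw [← assemble_coords m b]
    conv_rhs => rw [← assemble_coords m b]
    show markovTrace _ (_ * heckeIncl (m + 1)
      (∑ l : Fin (m + 2), heckeIncl m (coords m b l) * desc (m + 1) l)) =
      markovTrace _ (_ * ∑ l : Fin (m + 2), heckeIncl m (coords m b l) * desc (m + 1) l)
    rw [map_sum, Finset.mul_sum, Finset.mul_sum, map_sum, map_sum]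
    refine Finset.sum_congr rfl fun l _ => ?_
    rw [map_mul (heckeIncl (m + 1)), mul_assoc, ← mul_assoc (gen _), ← hecke_incl_incl_comm, mul_assoc,
      ← mul_assoc, ← map_mul (heckeIncl (m + 1)), ← desc_incl (m + 1) l.val (by omega), markovTrace_desc _ _ _ (by omega),
      mul_assoc]

theorem markovTrace_sq (m : ℕ) (p q : Hecke m) :
    markovTrace (m + 1) (heckeIncl m p * (gen (Fin.last m) * gen (Fin.last m)) * heckeIncl m q) =
      2 * s * markovTrace m (p * q) - s ^ 2 * (delta * markovTrace m (p * q)) := by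
  rw [gen_sq, mul_sub, sub_mul, map_sub, mul_smul_comm, mul_smul_comm, smul_mul_assoc,
    smul_mul_assoc, map_smul, map_smul, markovTrace_mark, mul_one, ← map_mul, markovTrace_incl]
  rfl

theorem markovTrace_braid (m : ℕ) (p q : Hecke (m + 1)) :
    markovTrace (m + 2) (heckeIncl (m + 1) p * gen (Fin.last (m + 1)) *
      heckeIncl (m + 1) (gen (Fin.last m)) * gen (Fin.last (m + 1)) * heckeIncl (m + 1) q) =
      2 * s * markovTrace (m + 1) (p * gen (Fin.last m) * q) -
        s ^ 2 * markovTrace (m + 1) (p * q) := by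
  have hb := gen_braid (m := m + 2) (i := (Fin.last m).castSucc) (j := Fin.last (m + 1)) rfl
  have e : heckeIncl (m + 1) p * gen (Fin.last (m + 1)) *
      heckeIncl (m + 1) (gen (Fin.last m)) * gen (Fin.last (m + 1)) * heckeIncl (m + 1) q =
      heckeIncl (m + 1) (p * gen (Fin.last m)) * gen (Fin.last (m + 1)) *
        heckeIncl (m + 1) (gen (Fin.last m) * q) := by
    rw [map_mul, map_mul, heckeIncl_gen, mul_assoc (heckeIncl (m + 1) p),
      mul_assoc (heckeIncl (m + 1) p), ← hb]
    simp only [mul_assoc]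
  rw [e, markovTrace_mark, mul_assoc, ← mul_assoc (gen _), gen_sq, sub_mul, mul_sub, map_sub]
  simp only [smul_mul_assoc, mul_smul_comm, map_smul, one_mul, smul_eq_mul, mul_assoc]

theorem markovTrace_key (m : ℕ) (a b : Hecke m) :
    markovTrace (m + 1) (gen (Fin.last m) * heckeIncl m a * gen (Fin.last m) * heckeIncl m b) =
      markovTrace (m + 1)
        (heckeIncl m a * gen (Fin.last m) * heckeIncl m b * gen (Fin.last m)) := by
  cases m with
  | zero =>
    obtain ⟨c, rfl⟩ := hecke_zero a
    obtain ⟨d, rfl⟩ := hecke_zero b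
    simp only [map_smul, map_one, mul_smul_comm, smul_mul_assoc, mul_one, one_mul]
  | succ m =>
    have hc := hecke_incl_incl_comm (m := m)
    let G : Hecke (m + 2) := gen (Fin.last (m + 1))
    let J := heckeIncl (m + 1)
    let I := heckeIncl m
    let g : Hecke (m + 1) := gen (Fin.last m)
    have hc : ∀ y, J (I y) * G = G * J (I y) := fun y => hecke_incl_incl_comm y
    have hc' : ∀ y z, J (I y) * (G * z) = G * (J (I y) * z) := fun y z => by
      rw [← mul_assoc, hc, mul_assoc]
    have sq : ∀ p q, markovTrace (m + 2) (J p * (G * G) * J q) =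
      2 * s * markovTrace (m + 1) (p * q) - s ^ 2 * (delta * markovTrace (m + 1) (p * q)) :=
      markovTrace_sq (m + 1)
    have br : ∀ p q, markovTrace (m + 2) (J p * G * J g * G * J q) =
      2 * s * markovTrace (m + 1) (p * g * q) - s ^ 2 * markovTrace (m + 1) (p * q) :=
      markovTrace_braid m
    have mk : ∀ p q, markovTrace (m + 1) (I p * g * I q) = markovTrace m (p * q) :=
      markovTrace_mark m
    have inc : ∀ p, markovTrace (m + 1) (I p) = delta * markovTrace m p := markovTrace_incl m
    have left : ∀ (x : Hecke m) (b), G * J (I x) * G * J b = J (I x) * (G * G) * J b :=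
      fun x b => by simp only [mul_assoc, hc']
    have left' : ∀ (x y : Hecke m) (b), G * J (I x * g * I y) * G * J b =
        J (I x) * G * J g * G * J (I y * b) := fun x y b => by
      simp only [map_mul, mul_assoc, hc']
    have right : ∀ (y : Hecke m) (a), J a * G * J (I y) * G = J a * (G * G) * J (I y) :=
      fun x b => by simp only [mul_assoc, hc]
    have right' : ∀ (x y : Hecke m) (a), J a * G * J (I x * g * I y) * G =
        J (a * I x) * G * J g * G * J (I y) := fun x y a => by
      simp only [map_mul, mul_assoc, hc]
    let T := markovTrace (m + 2)
    show T (G * J a * G * J b) = T (J a * G * J b * G)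
    let f1 : Hecke (m + 1) →ₗ[Coeff] Hecke (m + 1) →ₗ[Coeff] Coeff :=
      LinearMap.mk₂ Coeff (fun a b => T (G * J a * G * J b))
        (fun _ _ _ => by simp only [map_add, mul_add, add_mul])
        (fun _ _ _ => by simp only [map_smul, mul_smul_comm, smul_mul_assoc])
        (fun _ _ _ => by simp only [map_add, mul_add])
        (fun _ _ _ => by simp only [map_smul, mul_smul_comm])
    let f2 : Hecke (m + 1) →ₗ[Coeff] Hecke (m + 1) →ₗ[Coeff] Coeff :=
      LinearMap.mk₂ Coeff (fun a b => T (J a * G * J b * G))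
        (fun _ _ _ => by simp only [map_add, add_mul])
        (fun _ _ _ => by simp only [map_smul, smul_mul_assoc])
        (fun _ _ _ => by simp only [map_add, mul_add, add_mul])
        (fun _ _ _ => by simp only [map_smul, mul_smul_comm, smul_mul_assoc])
    suffices H : f1 a = f2 a from LinearMap.congr_fun H b
    refine hecke_span_induction (LinearMap.eqLocus f1 f2) (fun x => ?_) (fun x1 x2 => ?_) a
    · show f1 (I x) = f2 (I x)
      refine LinearMap.ext fun b => ?_
      refine hecke_span_induction (LinearMap.eqLocus (f1 (I x)) (f2 (I x)))
        (fun y => ?_) (fun y1 y2 => ?_) b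
      · show T (G * J (I x) * G * J (I y)) = T (J (I x) * G * J (I y) * G)
        rw [left, right]
      · show T (G * J (I x) * G * J (I y1 * g * I y2)) = T (J (I x) * G * J (I y1 * g * I y2) * G)
        rw [left, right', sq, br, ← map_mul, ← mul_assoc, ← mul_assoc, ← map_mul, mk, ← map_mul,
          inc]
    · show f1 (I x1 * g * I x2) = f2 (I x1 * g * I x2)
      refine LinearMap.ext fun b => ?_
      refine hecke_span_induction (LinearMap.eqLocus (f1 (I x1 * g * I x2))
        (f2 (I x1 * g * I x2))) (fun y => ?_) (fun y1 y2 => ?_) b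
      · show T (G * J (I x1 * g * I x2) * G * J (I y)) = T (J (I x1 * g * I x2) * G * J (I y) * G)
        rw [left', right, sq, br, mul_assoc _ (I x2), ← map_mul, ← map_mul, mk, inc]
      · show T (G * J (I x1 * g * I x2) * G * J (I y1 * g * I y2)) =
          T (J (I x1 * g * I x2) * G * J (I y1 * g * I y2) * G)
        rw [left', right', br, br]
        have e1 : I x1 * (I x2 * (I y1 * g * I y2)) = I (x1 * x2 * y1) * g * I y2 := by
          simp only [map_mul, mul_assoc]
        have e2 : I x1 * g * I x2 * I y1 * I y2 = I x1 * g * I (x2 * y1 * y2) := by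
          simp only [map_mul, mul_assoc]
        rw [e1, e2, mk, mk]
        simp only [mul_assoc]

theorem markovTrace_comm (m : ℕ) (x y : Hecke m) :
    markovTrace m (x * y) = markovTrace m (y * x) := by
  induction m with
  | zero =>
    obtain ⟨c, rfl⟩ := hecke_zero x
    simp only [smul_mul_assoc, mul_smul_comm, one_mul, mul_one]
  | succ m ih =>
    let T := markovTrace (m + 1)
    let I := heckeIncl m
    let g : Hecke (m + 1) := gen (Fin.last m)
    have mk : ∀ p q, T (I p * g * I q) = markovTrace m (p * q) := markovTrace_mark m
    have mk1 : ∀ p, T (I p * g) = markovTrace m p := fun p => by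
      have := mk p 1; rwa [map_one, mul_one, mul_one] at this
    have mk2 : ∀ p, T (g * I p) = markovTrace m p := fun p => by
      have := mk 1 p; rwa [map_one, one_mul, one_mul] at this
    have inc : ∀ p, T (I p) = delta * markovTrace m p := markovTrace_incl m
    have A : ∀ a h, T (I a * h) = T (h * I a) := fun a h => by
      refine hecke_span_induction (LinearMap.eqLocus (T.comp (LinearMap.mulLeft Coeff (I a)))
        (T.comp (LinearMap.mulRight Coeff (I a)))) (fun x => ?_) (fun x1 x2 => ?_) h
      · show T (I a * I x) = T (I x * I a)
        rw [← map_mul, ← map_mul, inc, inc, ih]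
      · show T (I a * (I x1 * g * I x2)) = T (I x1 * g * I x2 * I a)
        rw [← mul_assoc, ← mul_assoc, ← map_mul, mul_assoc _ (I x2), ← map_mul, mk, mk, mul_assoc,
          ih, mul_assoc]
    have B : ∀ h, T (g * h) = T (h * g) := fun h => by
      refine hecke_span_induction (LinearMap.eqLocus (T.comp (LinearMap.mulLeft Coeff g))
        (T.comp (LinearMap.mulRight Coeff g))) (fun x => ?_) (fun x1 x2 => ?_) h
      · show T (g * I x) = T (I x * g)
        rw [mk1, mk2]
      · show T (g * (I x1 * g * I x2)) = T (I x1 * g * I x2 * g)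
        rw [← mul_assoc, ← mul_assoc]
        exact markovTrace_key m x1 x2
    refine hecke_span_induction (LinearMap.eqLocus (T.comp (LinearMap.mulRight Coeff y))
        (T.comp (LinearMap.mulLeft Coeff y))) (fun a => ?_) (fun a b => ?_) x
    · exact A a y
    · show T (I a * g * I b * y) = T (y * (I a * g * I b))
      rw [mul_assoc, mul_assoc, A, mul_assoc, B, mul_assoc, mul_assoc, A]
      simp only [mul_assoc]


theorem gen_mul_inv {m : ℕ} (i : Fin m) :
    gen i * ((2 * sInv) • (1 : Hecke m) - (sInv ^ 2) • gen i) = 1 := by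
  rw [mul_sub, mul_smul_comm, mul_smul_comm, gen_sq, mul_one, smul_sub, smul_smul, smul_smul]
  have h1 : sInv ^ 2 * (2 * s) = 2 * sInv := by linear_combination (2 * sInv) * s_mul_sInv
  have h2 : sInv ^ 2 * s ^ 2 = 1 := by linear_combination (1 + s * sInv) * s_mul_sInv
  rw [h1, h2, one_smul]; abel

/-- The generators as units. -/
def genUnit {m : ℕ} (i : Fin m) : (Hecke m)ˣ where
  val := gen i
  inv := (2 * sInv) • 1 - (sInv ^ 2) • gen i
  val_inv := gen_mul_inv i
  inv_val := by
    have h := gen_mul_inv i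
    rw [mul_sub, mul_smul_comm, mul_smul_comm, mul_one] at h
    rw [sub_mul, smul_mul_assoc, smul_mul_assoc, one_mul, h]

/-- The map from the braid group to the Hecke algebra. -/
def braidHecke (m : ℕ) : BraidGroup m →* (Hecke m)ˣ :=
  braidLift genUnit (fun _ _ h => Units.ext (gen_comm h)) (fun _ _ h => Units.ext (gen_braid h))

theorem braidHecke_artin {m : ℕ} (i : Fin m) : (braidHecke m (artin i)).val = gen i := by
  rw [braidHecke, braidLift_artin]; rfl

theorem braidHecke_artin_inv {m : ℕ} (i : Fin m) :
    (braidHecke m (artin i)⁻¹).val = (2 * sInv) • 1 - (sInv ^ 2) • gen i := by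
  rw [map_inv, braidHecke, braidLift_artin]; rfl

theorem braidHecke_incl (m : ℕ) (β : BraidGroup m) :
    (braidHecke (m + 1) (braidIncl m β)).val = heckeIncl m (braidHecke m β).val := by
  have H : braidHecke (m + 1) (braidIncl m β) =
      Units.map (heckeIncl m : Hecke m →* Hecke (m + 1)) (braidHecke m β) := by
    refine braid_induction (p := fun β => braidHecke (m + 1) (braidIncl m β) =
      Units.map (heckeIncl m : Hecke m →* Hecke (m + 1)) (braidHecke m β))
      (by simp only [map_one]) (fun i => Units.ext ?_)
      (fun x y hx hy => by simp only [map_mul, hx, hy])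
      (fun x hx => by simp only [map_inv, hx]) β
    show _ = heckeIncl m (braidHecke m (artin i)).val
    rw [braidIncl, braidLift_artin, braidHecke_artin, braidHecke_artin, heckeIncl_gen]
  rw [H]; rfl

/-- The axioms of `D` can be satisfied. -/
theorem exists_degeneratePolynomial : ∃ D, IsDegeneratePolynomial D := by
  refine ⟨Quot.lift (fun b => markovTrace b.1 (braidHecke b.1 b.2).val) ?_, ?_, ?_⟩
  · rintro _ _ (⟨m, α, β⟩ | ⟨m, β⟩ | ⟨m, β⟩)
    · simp only [map_mul, Units.val_mul]; exact markovTrace_comm ..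
    · simp only [map_mul, Units.val_mul, braidHecke_incl, braidHecke_artin]
      have := markovTrace_mark m (braidHecke m β).val 1
      rw [map_one, mul_one, mul_one] at this
      exact this.symm
    · simp only [map_mul, Units.val_mul, braidHecke_incl, braidHecke_artin_inv]
      have := markovTrace_mark m (braidHecke m β).val 1
      rw [map_one, mul_one, mul_one] at this
      rw [mul_sub, mul_smul_comm, mul_smul_comm, mul_one, map_sub, map_smul, map_smul, this,
        markovTrace_incl, smul_eq_mul, smul_eq_mul]
      linear_combination (-sInv * markovTrace m (braidHecke m β).val) * two_mul_delta -
        markovTrace m (braidHecke m β).val * s_mul_sInv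
  · show markovTrace 0 (braidHecke 0 1).val = 1
    rw [map_one]; exact markovTrace_zero_one
  · intro m α β i
    show s * markovTrace m (braidHecke m (α * (artin i)⁻¹ * β)).val +
      sInv * markovTrace m (braidHecke m (α * artin i * β)).val =
      2 * markovTrace m (braidHecke m (α * β)).val
    simp only [map_mul, Units.val_mul, braidHecke_artin_inv, braidHecke_artin, mul_sub, sub_mul,
      mul_smul_comm, smul_mul_assoc, mul_one, map_sub, map_smul, smul_eq_mul]
    generalize markovTrace m (_ * gen i * _) = x
    generalize markovTrace m (_ * _) = y
    linear_combination (2 * y - sInv * x) * s_mul_sInv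

/-- The functions on the braid group that satisfy the skein relation. -/
def skeinFunctions (m : ℕ) : Submodule Coeff (BraidGroup m → Coeff) where
  carrier := {f | ∀ (β : BraidGroup m) (α : BraidGroup m) (i : Fin m),
    s * f (α * (artin i)⁻¹ * β) + sInv * f (α * artin i * β) = 2 * f (α * β)}
  add_mem' {f g} hf hg β α i := by
    simp only [Pi.add_apply]; linear_combination hf β α i + hg β α i
  zero_mem' β α i := by simp
  smul_mem' c f hf β α i := by
    simp only [Pi.smul_apply, smul_eq_mul]; linear_combination c * hf β α i

/-- Right translation on these functions. -/
def translate {m : ℕ} (γ : BraidGroup m) : Module.End Coeff (skeinFunctions m) where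
  toFun f := ⟨fun β => f.1 (β * γ), fun β α i => by
    have := f.2 (β * γ) α i
    simpa only [mul_assoc] using this⟩
  map_add' _ _ := rfl
  map_smul' _ _ := rfl

theorem translate_mul {m : ℕ} (γ γ' : BraidGroup m) :
    translate (γ * γ') = translate γ * translate γ' := by
  refine LinearMap.ext fun f => Subtype.ext (funext fun β => ?_)
  show f.1 (β * (γ * γ')) = f.1 (β * γ * γ')
  rw [mul_assoc]

theorem translate_one {m : ℕ} : translate (1 : BraidGroup m) = 1 := by
  refine LinearMap.ext fun f => Subtype.ext (funext fun β => ?_)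
  show f.1 (β * 1) = f.1 β
  rw [mul_one]

/-- The action of the Hecke algebra on these functions. -/
def heckeTranslate (m : ℕ) : Hecke m →ₐ[Coeff] Module.End Coeff (skeinFunctions m) :=
  heckeLift (fun i => translate (artin i))
    (fun i j h => by rw [← translate_mul, ← translate_mul, artin_comm h])
    (fun i j h => by simp only [← translate_mul]; rw [artin_braid h])
    (fun i => by
      refine LinearMap.ext fun f => Subtype.ext (funext fun β => ?_)
      show f.1 (β * artin i * artin i) = 2 * s * f.1 (β * artin i) - s ^ 2 * f.1 β
      have h := f.2 (artin i) β i
      rw [inv_mul_cancel_right] at h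
      linear_combination s * h - f.1 (β * artin i * artin i) * s_mul_sInv)

theorem heckeTranslate_braid {m : ℕ} (β : BraidGroup m) :
    heckeTranslate m (braidHecke m β).val = translate β := by
  refine braid_induction (p := fun β => heckeTranslate m (braidHecke m β).val = translate β)
    ?_ (fun i => ?_) (fun x y hx hy => ?_) (fun x hx => ?_) β
  · rw [map_one, Units.val_one, map_one, translate_one]
  · rw [braidHecke_artin, heckeTranslate, heckeLift_gen]
  · rw [map_mul, Units.val_mul, map_mul, hx, hy, translate_mul]
  · refine left_inv_eq_right_inv (a := translate x) ?_ ?_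
    · rw [← hx, ← map_mul, ← Units.val_mul, ← map_mul, inv_mul_cancel, map_one, Units.val_one,
        map_one]
    · rw [← translate_mul, mul_inv_cancel, translate_one]

theorem hecke_braid_induction {m : ℕ} (S : Submodule Coeff (Hecke m))
    (h : ∀ β, (braidHecke m β).val ∈ S) (x : Hecke m) : x ∈ S := by
  have : x ∈ Submodule.span Coeff (Set.range fun β => (braidHecke m β).val) := by
    refine hecke_induction (Submodule.span Coeff (Set.range fun β => (braidHecke m β).val))
      (Submodule.subset_span ⟨1, by simp only [map_one, Units.val_one]⟩)
      (fun x hx i => ?_) x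
    induction hx using Submodule.span_induction with
    | mem x h =>
      obtain ⟨β, rfl⟩ := h
      exact Submodule.subset_span ⟨β * artin i, by
        simp only [map_mul, Units.val_mul, braidHecke_artin]⟩
    | zero => rw [zero_mul]; exact Submodule.zero_mem _
    | add x y _ _ hx hy => rw [add_mul]; exact Submodule.add_mem _ hx hy
    | smul c x _ hx => rw [smul_mul_assoc]; exact Submodule.smul_mem _ c hx
  refine (Submodule.span_le (p := S)).2 ?_ this
  rintro _ ⟨β, rfl⟩
  exact h β

theorem IsDegeneratePolynomial.eq_markovTrace {D : OrientedLink → Coeff}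
    (hD : IsDegeneratePolynomial D) (m : ℕ) (β : BraidGroup m) :
    D (braidClosure β) = markovTrace m (braidHecke m β).val := by
  let F (m : ℕ) : Hecke m →ₗ[Coeff] Coeff :=
    { toFun := fun h => (heckeTranslate m h
        ⟨fun β => D (braidClosure β), fun β α i => hD.skein m α β i⟩).1 1
      map_add' := fun x y => by rw [map_add]; rfl
      map_smul' := fun c x => by rw [map_smul]; rfl }
  have hF : ∀ m (β : BraidGroup m), F m (braidHecke m β).val = D (braidClosure β) := fun m β => by
    show (heckeTranslate m (braidHecke m β).val _).1 1 = _
    rw [heckeTranslate_braid]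
    show D (braidClosure (1 * β)) = _
    rw [one_mul]
  suffices H : ∀ m, F m = markovTrace m by rw [← hF, H]
  intro m
  induction m with
  | zero =>
    refine LinearMap.ext fun h => ?_
    obtain ⟨c, rfl⟩ := hecke_zero h
    rw [map_smul, map_smul, markovTrace_zero_one]
    have := hF 0 1
    rw [map_one, Units.val_one, hD.unknot] at this
    rw [this]
  | succ m ih =>
    have cj : ∀ {m : ℕ} (α β : BraidGroup m), D (braidClosure (α * β)) = D (braidClosure (β * α)) :=
      fun α β => congrArg D (Quot.sound (MarkovMove.conj _ α β))
    have st : ∀ β : BraidGroup m, D (braidClosure (braidIncl m β * artin (Fin.last m))) =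
      D (braidClosure β) := fun β => congrArg D (Quot.sound (MarkovMove.stab m β)).symm
    have st' : ∀ β : BraidGroup m, D (braidClosure (braidIncl m β * (artin (Fin.last m))⁻¹)) =
      D (braidClosure β) := fun β => congrArg D (Quot.sound (MarkovMove.stab_inv m β)).symm
    have h2 : (2 : Coeff) ≠ 0 := fun h => by
      have := two_mul_half; rw [h, zero_mul] at this; exact zero_ne_one this
    have inc : ∀ β : BraidGroup m, D (braidClosure (braidIncl m β)) = delta * D (braidClosure β) := fun β => by
      have h := hD.skein (m + 1) (braidIncl m β) 1 (Fin.last m)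
      rw [mul_one, mul_one, mul_one, st, st'] at h
      refine mul_left_cancel₀ h2 ?_
      linear_combination -h - D (braidClosure β) * two_mul_delta
    refine LinearMap.ext fun h => ?_
    refine hecke_span_induction (LinearMap.eqLocus (F (m + 1)) (markovTrace (m + 1)))
      (fun a => ?_) (fun a b => ?_) h
    · show F (m + 1) (heckeIncl m a) = markovTrace (m + 1) (heckeIncl m a)
      rw [markovTrace_incl, ← ih]
      refine hecke_braid_induction (LinearMap.eqLocus ((F (m + 1)).comp (heckeIncl m).toLinearMap)
        (delta • F m)) (fun β => ?_) a
      show F (m + 1) (heckeIncl m (braidHecke m β).val) = delta * F m (braidHecke m β).val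
      rw [← braidHecke_incl, hF, hF, inc]
    · show F (m + 1) (heckeIncl m a * gen (Fin.last m) * heckeIncl m b) =
        markovTrace (m + 1) (heckeIncl m a * gen (Fin.last m) * heckeIncl m b)
      rw [markovTrace_mark, ← ih]
      let f : Hecke m →ₗ[Coeff] Hecke m →ₗ[Coeff] Coeff :=
        LinearMap.mk₂ Coeff
          (fun a b => F (m + 1) (heckeIncl m a * gen (Fin.last m) * heckeIncl m b))
          (fun _ _ _ => by simp only [map_add, add_mul])
          (fun _ _ _ => by simp only [map_smul, smul_mul_assoc])
          (fun _ _ _ => by simp only [map_add, mul_add])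
          (fun _ _ _ => by simp only [map_smul, mul_smul_comm])
      let f' : Hecke m →ₗ[Coeff] Hecke m →ₗ[Coeff] Coeff :=
        LinearMap.mk₂ Coeff (fun a b => F m (a * b))
          (fun _ _ _ => by simp only [map_add, add_mul])
          (fun _ _ _ => by simp only [map_smul, smul_mul_assoc])
          (fun _ _ _ => by simp only [map_add, mul_add])
          (fun _ _ _ => by simp only [map_smul, mul_smul_comm])
      suffices H : f a = f' a from LinearMap.congr_fun H b
      refine hecke_braid_induction (LinearMap.eqLocus f f') (fun α => LinearMap.ext fun b => ?_) a
      refine hecke_braid_induction (LinearMap.eqLocus (f (braidHecke m α).val)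
        (f' (braidHecke m α).val)) (fun β => ?_) b
      show F (m + 1) (heckeIncl m (braidHecke m α).val * gen (Fin.last m) *
        heckeIncl m (braidHecke m β).val) = F m ((braidHecke m α).val * (braidHecke m β).val)
      rw [← braidHecke_incl, ← braidHecke_incl, ← braidHecke_artin, ← Units.val_mul,
        ← Units.val_mul, ← Units.val_mul, ← map_mul, ← map_mul, ← map_mul, hF, hF, cj, ← mul_assoc,
        ← map_mul, st, cj]

/-- There is exactly one function on oriented links that satisfies the axioms of `D`. -/
theorem existsUnique_degeneratePolynomial : ∃! D, IsDegeneratePolynomial D := by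
  obtain ⟨D, hD⟩ := exists_degeneratePolynomial
  refine ⟨D, hD, fun D' hD' => funext fun L => ?_⟩
  obtain ⟨⟨m, β⟩, rfl⟩ := Quot.exists_rep L
  exact (hD'.eq_markovTrace m β).trans (hD.eq_markovTrace m β).symm

/-- The degenerate polynomial `D` of an oriented link: the unique function that satisfies the
normalization and the skein relation. -/
def degeneratePolynomial : OrientedLink → Coeff := existsUnique_degeneratePolynomial.choose

theorem degeneratePolynomial_spec : IsDegeneratePolynomial degeneratePolynomial :=
  existsUnique_degeneratePolynomial.choose_spec.1

/-- The braid `x_{i_1}^{a_1} ⋯ x_{i_k}^{a_k}`. -/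
def braidWord {m k : ℕ} (i : Fin k → Fin m) (a : Fin k → ℤ) : BraidGroup m :=
  (List.ofFn fun r => artin (i r) ^ a r).prod

/-- The polynomial `D_n(x_{i_1}^{a_1} ⋯ x_{i_k}^{a_k})`, for `n = m + 1`. As a function of
`a : ℤ^k`, this is also the formal series `∑ D_n(x_{i_1}^{a_1} ⋯ x_{i_k}^{a_k}) t^a` over `ℤ^k`,
given by its coefficients. -/
def dPoly {m k : ℕ} (i : Fin k → Fin m) (a : Fin k → ℤ) : Coeff :=
  degeneratePolynomial (braidClosure (braidWord i a))

/-- The power series `∑ D_n(x_{i_1}^{a_1} ⋯ x_{i_k}^{a_k}) t^a` over `a : ℕ^k`. -/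
def dSeries {m k : ℕ} (i : Fin k → Fin m) : MvPowerSeries (Fin k) Coeff :=
  fun a => dPoly i fun r => (a r : ℤ)

/-- `e(τ) = (1 - s τ)²`, at the variable `τ = t_r`. -/
def ePoly {k : ℕ} (r : Fin k) : MvPolynomial (Fin k) Coeff :=
  (1 - MvPolynomial.C s * MvPolynomial.X r) ^ 2

/-- `E_0(τ) = 1 - 2 s τ` and `E_1(τ) = τ`, at the variable `τ = t_r`. -/
def EPoly {k : ℕ} (j : Fin 2) (r : Fin k) : MvPolynomial (Fin k) Coeff :=
  if j = 0 then 1 - 2 * MvPolynomial.C s * MvPolynomial.X r else MvPolynomial.X r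

/-- The numerator `∑ E_{j_1}(t_1) ⋯ E_{j_k}(t_k) D_n(x_{i_1}^{j_1} ⋯ x_{i_k}^{j_k})`, the sum being
over `j : {0,1}^k`. -/
def dNumerator {m k : ℕ} (i : Fin k → Fin m) : MvPolynomial (Fin k) Coeff :=
  ∑ j : Fin k → Fin 2, (∏ r, EPoly (j r) r) * MvPolynomial.C (dPoly i fun r => ((j r).val : ℤ))

/-- The product of a polynomial in `t_1, …, t_k` and a formal series over `ℤ^k`. -/
def polyMul {k : ℕ} (p : MvPolynomial (Fin k) Coeff) (f : (Fin k → ℤ) → Coeff) :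
    (Fin k → ℤ) → Coeff :=
  fun b => ∑ a ∈ p.support, p.coeff a * f fun r => b r - (a r : ℤ)

/-- The part of a formal series over `ℤ^k` in which the exponent of `t_r` is negative for `r ∈ N`
and nonnegative for `r ∉ N`. -/
def orthantPart {k : ℕ} (N : Finset (Fin k)) (f : (Fin k → ℤ) → Coeff) : (Fin k → ℤ) → Coeff :=
  open Classical in fun a => if ∀ r, a r < 0 ↔ r ∈ N then f a else 0

end DegenerateLink

end

open DegenerateLink

noncomputable section
namespace DegenerateLink

/-! Vary one exponent `a_r = n` and fix the others. The skein relation applied at the crossings of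
`x_{i_r}` says that the resulting function `g` of `n` satisfies `s g(n-1) + s⁻¹ g(n+1) = 2 g(n)`.
The characteristic polynomial `(X - s)²` has the double root `s`, which is a unit, so the solutions
on all of `ℤ` are free on the values at `0` and `1`: `g(n) = (1-n) sⁿ g(0) + n sⁿ⁻¹ g(1)`
(`eq_fundamentalSolution`). Expanding every exponent in this way writes `D_n(x_{i_1}^{a_1} ⋯
x_{i_k}^{a_k})` as a sum, over `j` in `{0,1}^k`, of `D_n(x_{i_1}^{j_1} ⋯ x_{i_k}^{j_k})` times a
product of functions of one exponent each (`dPoly_eq_sum`).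

The rest is a computation in one variable. The polynomial `e(τ) = (1 - sτ)²` kills the two-sided
series of each fundamental solution. Cutting that series to exponents `n ≥ 0` leaves only boundary
terms, in degrees `0` and `1`, and these are exactly `E_j` (`fundamentalSolution_nonneg_part`).
Since the two halves add up to a series killed by `e`, the half `n < 0` gives `-E_j`
(`fundamentalSolution_neg_part`).

The indicator of an orthant is also a product over the coordinates, so the variables can be treated
separately (`polyMul_prod`). Each negative coordinate contributes one sign, whence `(-1)^|S|`
(`polyMul_orthantPart_dPoly`). The power series identity is the case `S = ∅`, divided by the
invertible series `e(t_1) ⋯ e(t_k)`. -/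

/-! ### The skein recurrence and its fundamental solutions -/

/-- The solutions `c` of `c (n + 2) = 2 s c (n + 1) - s² c n` with `c 0, c 1` equal to `1, 0` and to
`0, 1`. -/
def fundamentalSolution (j : Fin 2) (n : ℤ) : Coeff :=
  if j = 0 then (1 - (n : Coeff)) * LaurentPolynomial.T n else (n : Coeff) * LaurentPolynomial.T (n - 1)

theorem T_sub_one (n : ℤ) : (LaurentPolynomial.T (n - 1) : Coeff) = LaurentPolynomial.T n * sInv :=
  LaurentPolynomial.T_add n (-1)

theorem T_add_one (n : ℤ) : (LaurentPolynomial.T (n + 1) : Coeff) = LaurentPolynomial.T n * s :=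
  LaurentPolynomial.T_add n 1

/-- Both outer coefficients `s` and `s⁻¹` are units, so the recurrence can be run in either
direction and two consecutive values determine `g` on all of `ℤ`. -/
theorem eq_fundamentalSolution {g : ℤ → Coeff}
    (hg : ∀ n, s * g (n - 1) + sInv * g (n + 1) = 2 * g n) (n : ℤ) :
    g n = fundamentalSolution 0 n * g 0 + fundamentalSolution 1 n * g 1 := by
  -- The recurrence has order two, so the induction carries two consecutive values.
  suffices H : g n = fundamentalSolution 0 n * g 0 + fundamentalSolution 1 n * g 1 ∧
      g (n + 1) = fundamentalSolution 0 (n + 1) * g 0 + fundamentalSolution 1 (n + 1) * g 1 from H.1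
  have hs := s_mul_sInv
  simp only [fundamentalSolution, if_true, if_neg (one_ne_zero : (1 : Fin 2) ≠ 0)]
  induction n using Int.induction_on with
  | zero => simp
  | succ n ih =>
    refine ⟨ih.2, ?_⟩
    obtain ⟨h1, h2⟩ := ih
    have h := hg (n + 1)
    simp only [add_sub_cancel_right, T_sub_one, T_add_one] at h h1 h2 ⊢
    push_cast at h h1 h2 ⊢
    rw [h1, h2] at h
    generalize (LaurentPolynomial.T (n : ℤ) : Coeff) = t at *
    -- Multiplying the recurrence by `s` isolates `g (n + 2)`; the multiple of `hs` cancels the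
    -- products `s * sInv`.
    linear_combination s * h - (g (n + 1 + 1) + s * n * t * g 1) * hs
  | pred n ih =>
    refine ⟨?_, by rw [sub_add_cancel]; exact ih.1⟩
    obtain ⟨h1, h2⟩ := ih
    have h := hg (-n)
    simp only [T_sub_one, T_add_one, add_sub_cancel_right] at h h1 h2 ⊢
    push_cast at h h1 h2 ⊢
    rw [h1, h2] at h
    generalize (LaurentPolynomial.T (-n : ℤ) : Coeff) = t at *
    -- Downwards it is `g (-n - 1)` that has to be isolated, hence the factor `sInv`.
    linear_combination sInv * h - (g (-n - 1) + sInv * n * t * g 0) * hs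

/-- The skein relation at one extra crossing next to `x_i ^ n` relates the exponents `n - 1`, `n`
and `n + 1`, which is the recurrence of `eq_fundamentalSolution`. -/
theorem degeneratePolynomial_zpow {m : ℕ} (α β : BraidGroup m) (i : Fin m) (n : ℤ) :
    degeneratePolynomial (braidClosure (α * artin i ^ n * β)) =
      ∑ j, fundamentalSolution j n *
        degeneratePolynomial (braidClosure (α * artin i ^ (j.val : ℤ) * β)) := by
  rw [Fin.sum_univ_two]
  refine eq_fundamentalSolution
    (g := fun n => degeneratePolynomial (braidClosure (α * artin i ^ n * β))) (fun n => ?_) n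
  have h := degeneratePolynomial_spec.skein m (α * artin i ^ n) β i
  rwa [mul_assoc α, ← zpow_sub_one, mul_assoc α (artin i ^ n) (artin i), ← zpow_add_one] at h

theorem braidWord_succ {m k : ℕ} (i : Fin (k + 1) → Fin m) (a : Fin (k + 1) → ℤ) :
    braidWord i a = artin (i 0) ^ a 0 * braidWord (Fin.tail i) (Fin.tail a) := by
  rw [braidWord, List.ofFn_succ, List.prod_cons]; rfl

/-- The prefix `α` makes the induction on `k` work: once the first power is expanded, the remaining
factor `x ^ j` with `j ∈ {0, 1}` is absorbed into `α`. -/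
theorem degeneratePolynomial_mul_braidWord {m k : ℕ} (α : BraidGroup m) (i : Fin k → Fin m)
    (a : Fin k → ℤ) :
    degeneratePolynomial (braidClosure (α * braidWord i a)) =
      ∑ j : Fin k → Fin 2, (∏ r, fundamentalSolution (j r) (a r)) *
        degeneratePolynomial (braidClosure (α * braidWord i fun r => ((j r).val : ℤ))) := by
  induction k generalizing α with
  | zero => simp [braidWord]
  | succ k ih =>
    -- The sum over `{0,1}^(k+1)` is split into the first index and the remaining ones.
    rw [braidWord_succ, ← mul_assoc, degeneratePolynomial_zpow,
      ← (Fin.consEquiv fun _ => Fin 2).sum_comp, Fintype.sum_prod_type]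
    refine Finset.sum_congr rfl fun j _ => ?_
    rw [ih, Finset.mul_sum]
    refine Finset.sum_congr rfl fun j' _ => ?_
    rw [Fin.prod_univ_succ, braidWord_succ, ← mul_assoc, mul_assoc α]
    rfl

theorem dPoly_eq_sum {m k : ℕ} (i : Fin k → Fin m) (a : Fin k → ℤ) :
    dPoly i a = ∑ j : Fin k → Fin 2,
      (∏ r, fundamentalSolution (j r) (a r)) * dPoly i fun r => ((j r).val : ℤ) := by
  have h := degeneratePolynomial_mul_braidWord 1 i a
  simp only [one_mul] at h
  exact h

/-! ### Polynomials acting on formal series over `ℤ^k` -/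

section PolyMul

variable {k : ℕ}

theorem polyMul_add_left (p q : MvPolynomial (Fin k) Coeff) (f) :
    polyMul (p + q) f = polyMul p f + polyMul q f := by
  ext1 b
  -- Cancellation can make the support of `p + q` smaller than the union of the supports; terms with
  -- coefficient zero do not matter.
  exact Finsupp.sum_add_index' (f := AddMonoidAlgebra.coeff p) (g := AddMonoidAlgebra.coeff q)
    (h := fun a c => c * f fun r => b r - (a r : ℤ)) (fun _ => zero_mul _) fun _ _ _ => add_mul _ _ _

theorem polyMul_monomial (d : Fin k →₀ ℕ) (c : Coeff) (f) (b : Fin k → ℤ) :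
    polyMul (MvPolynomial.monomial d c) f b = c * f fun r => b r - (d r : ℤ) := by
  classical
  rw [polyMul, MvPolynomial.support_monomial]
  split_ifs with h
  · rw [h, zero_mul, Finset.sum_empty]
  · rw [Finset.sum_singleton, MvPolynomial.coeff_monomial, if_pos rfl]

theorem polyMul_sum_left {ι : Type*} (t : Finset ι) (p : ι → MvPolynomial (Fin k) Coeff) (f) :
    polyMul (∑ j ∈ t, p j) f = ∑ j ∈ t, polyMul (p j) f :=
  map_sum (AddMonoidHom.mk' (polyMul · f) fun p q => polyMul_add_left p q f) p t

theorem polyMul_sum_right {ι : Type*} (t : Finset ι) (p : MvPolynomial (Fin k) Coeff)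
    (f : ι → (Fin k → ℤ) → Coeff) :
    polyMul p (∑ j ∈ t, f j) = ∑ j ∈ t, polyMul p (f j) := by
  ext1 b
  simp only [polyMul, Finset.sum_apply, Finset.mul_sum]
  exact Finset.sum_comm

theorem polyMul_smul_right (c : Coeff) (p : MvPolynomial (Fin k) Coeff) (f) :
    polyMul p (c • f) = c • polyMul p f := by
  ext1 b
  simp only [polyMul, Pi.smul_apply, smul_eq_mul, Finset.mul_sum, mul_left_comm]

theorem polyMul_C (c : Coeff) (f : (Fin k → ℤ) → Coeff) : polyMul (MvPolynomial.C c) f = c • f := by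
  ext1 b
  simpa using polyMul_monomial 0 c f b

theorem polyMul_one (f : (Fin k → ℤ) → Coeff) : polyMul 1 f = f := by
  rw [← MvPolynomial.C_1, polyMul_C, one_smul]

/-- This makes the series over `ℤ^k` a module over the polynomials. By additivity it reduces to
monomials, where it says that shifts of the exponent compose. -/
theorem polyMul_mul (p q : MvPolynomial (Fin k) Coeff) (f) :
    polyMul (p * q) f = polyMul p (polyMul q f) := by
  have hadd : ∀ (p : MvPolynomial (Fin k) Coeff) (f g), polyMul p (f + g) = polyMul p f + polyMul p g :=
    fun p f g => by
      ext1 b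
      simp only [polyMul, Pi.add_apply, mul_add, Finset.sum_add_distrib]
  induction p using MvPolynomial.induction_on' with
  | add p p' hp hp' => rw [add_mul, polyMul_add_left, hp, hp', polyMul_add_left]
  | monomial d c =>
    induction q using MvPolynomial.induction_on' with
    | add q q' hq hq' => rw [mul_add, polyMul_add_left, hq, hq', polyMul_add_left, hadd]
    | monomial d' c' =>
      ext1 b
      rw [MvPolynomial.monomial_mul, polyMul_monomial, polyMul_monomial, polyMul_monomial, mul_assoc]
      simp only [Finsupp.add_apply, Nat.cast_add, sub_sub]

theorem polyMul_X (r : Fin k) (f : (Fin k → ℤ) → Coeff) (b : Fin k → ℤ) :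
    polyMul (MvPolynomial.X r) f b = f (b - Pi.single r 1) := by
  rw [MvPolynomial.X, polyMul_monomial, one_mul]
  congr 1
  ext r'
  rcases eq_or_ne r' r with rfl | h
  · simp
  · simp [h]

theorem polyMul_ePoly (r : Fin k) (f : (Fin k → ℤ) → Coeff) (b : Fin k → ℤ) :
    polyMul (ePoly r) f b =
      f b - 2 * s * f (b - Pi.single r 1) + s ^ 2 * f (b - Pi.single r 2) := by
  have h : (ePoly r : MvPolynomial (Fin k) Coeff) = 1 + MvPolynomial.C (-(2 * s)) * MvPolynomial.X r +
      MvPolynomial.C (s ^ 2) * (MvPolynomial.X r * MvPolynomial.X r) := by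
    simp only [ePoly, map_neg, map_mul, map_pow, map_ofNat]
    ring
  have h2 : b - Pi.single r 1 - Pi.single r 1 = b - Pi.single r 2 := by
    rw [sub_sub, ← Pi.single_add]; rfl
  simp only [h, polyMul_add_left, polyMul_mul, polyMul_one, polyMul_C, Pi.add_apply, Pi.smul_apply,
    polyMul_X, smul_eq_mul, h2]
  ring

theorem polyMul_EPoly_zero (r : Fin k) (f : (Fin k → ℤ) → Coeff) (b : Fin k → ℤ) :
    polyMul (EPoly 0 r) f b = f b - 2 * s * f (b - Pi.single r 1) := by
  have h : (EPoly 0 r : MvPolynomial (Fin k) Coeff) =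
      1 + MvPolynomial.C (-(2 * s)) * MvPolynomial.X r := by
    simp only [EPoly, if_true, map_neg, map_mul, map_ofNat]
    ring
  simp only [h, polyMul_add_left, polyMul_mul, polyMul_one, polyMul_C, Pi.add_apply, Pi.smul_apply,
    polyMul_X, smul_eq_mul]
  ring

theorem polyMul_EPoly_one (r : Fin k) (f : (Fin k → ℤ) → Coeff) (b : Fin k → ℤ) :
    polyMul (EPoly 1 r) f b = f (b - Pi.single r 1) := by
  rw [EPoly, if_neg one_ne_zero, polyMul_X]

/-- A product of polynomials in one variable each acts on a product of series in one variable each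
factor by factor. -/
theorem polyMul_prod {p : Fin k → MvPolynomial (Fin k) Coeff} {g h : Fin k → ℤ → Coeff}
    (H : ∀ r (u : (Fin k → ℤ) → Coeff), (∀ b n, u (b - Pi.single r n) = u b) →
      polyMul (p r) (fun b => g r (b r) * u b) = fun b => h r (b r) * u b) :
    polyMul (∏ r, p r) (fun b => ∏ r, g r (b r)) = fun b => ∏ r, h r (b r) := by
  -- The factors act one at a time: after those in `R`, the coordinates in `R` carry `h` and the
  -- others still carry `g`.
  suffices H' : ∀ R : Finset (Fin k), polyMul (∏ r ∈ R, p r) (fun b => ∏ r, g r (b r)) =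
      fun b => (∏ r ∈ R, h r (b r)) * ∏ r ∈ Rᶜ, g r (b r) by
    simpa using H' Finset.univ
  intro R
  induction R using Finset.induction_on with
  | empty => simp [polyMul_one]
  | insert r R hr ih =>
    -- This singles out the factor `g r`, on which the next polynomial acts. The product of all
    -- other factors does not depend on the coordinate `r`, so it can serve as `u` in `H`.
    have hR : Rᶜ = insert r (insert r R)ᶜ := by
      ext x
      by_cases hx : x = r <;> simp [hx, hr]
    have hr' : r ∉ (insert r R)ᶜ := by simp
    rw [Finset.prod_insert hr, polyMul_mul, ih, hR]
    simp only [Finset.prod_insert hr, Finset.prod_insert hr', mul_left_comm _ (g r _), mul_assoc]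
    refine H r _ fun b n => ?_
    congr 1 <;> refine Finset.prod_congr rfl fun x hx => ?_
    · rw [Pi.sub_apply, Pi.single_eq_of_ne (fun e => hr (by rwa [e] at hx)), sub_zero]
    · rw [Pi.sub_apply, Pi.single_eq_of_ne (fun e => hr' (by rwa [e] at hx)), sub_zero]

/-- The hypothesis is multiplication by `1 - 2sτ + s²τ²`, read off coefficient by coefficient in
each variable. -/
theorem polyMul_prod_ePoly {g h : Fin k → ℤ → Coeff}
    (H : ∀ r n, g r n - 2 * s * g r (n - 1) + s ^ 2 * g r (n - 2) = h r n) :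
    polyMul (∏ r, ePoly r) (fun b => ∏ r, g r (b r)) = fun b => ∏ r, h r (b r) := by
  refine polyMul_prod fun r u hu => funext fun b => ?_
  rw [polyMul_ePoly, hu, hu, ← H]
  simp only [Pi.sub_apply, Pi.single_eq_same]
  ring

end PolyMul

/-! ### One-variable series: `e` times the halves of a fundamental solution -/

/-- The coefficients of `E_j`. -/
def ECoeff (j : Fin 2) (n : ℤ) : Coeff :=
  if j = 0 then (if n = 0 then 1 else 0) - 2 * s * (if n = 1 then 1 else 0)
  else if n = 1 then 1 else 0

/-- `Pi.single 0 1` is the series `1`, so acting on it turns a polynomial into its family of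
coefficients. The series `1` is itself a product of one-variable delta functions, which makes
`polyMul_prod` applicable. -/
theorem polyMul_prod_EPoly {k : ℕ} (j : Fin k → Fin 2) :
    polyMul (∏ r, EPoly (j r) r) (Pi.single 0 1) = fun b => ∏ r, ECoeff (j r) (b r) := by
  have h : (Pi.single 0 1 : (Fin k → ℤ) → Coeff) = fun b => ∏ r, if b r = 0 then 1 else 0 := by
    ext1 b
    rw [Finset.prod_ite_zero, Finset.prod_const_one, Pi.single_apply]
    simp only [funext_iff, Pi.zero_apply, Finset.mem_univ, true_imp_iff]
  rw [h]
  refine polyMul_prod (g := fun _ n => if n = 0 then 1 else 0) fun r u hu => funext fun b => ?_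
  rcases (show ∀ l : Fin 2, l = 0 ∨ l = 1 by decide) (j r) with e | e <;> rw [e]
  · rw [polyMul_EPoly_zero, hu, ECoeff, if_pos rfl]
    simp only [Pi.sub_apply, Pi.single_eq_same, sub_eq_zero]
    ring
  · rw [polyMul_EPoly_one, hu, ECoeff, if_neg one_ne_zero]
    simp only [Pi.sub_apply, Pi.single_eq_same, sub_eq_zero]

/-- The whole two-sided series is annihilated by `(1 - sτ)²`, the reversed characteristic
polynomial. -/
theorem fundamentalSolution_rec (j : Fin 2) (n : ℤ) :
    fundamentalSolution j n - 2 * s * fundamentalSolution j (n - 1) +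
      s ^ 2 * fundamentalSolution j (n - 2) = 0 := by
  have h2 : n - 2 = n - 1 - 1 := by ring
  simp only [fundamentalSolution, h2, T_sub_one]
  push_cast
  generalize (LaurentPolynomial.T n : Coeff) = t
  have hs := s_mul_sInv
  split_ifs
  · linear_combination (t * (n - 2) * 2 - (n - 3) * t * (s * sInv + 1)) * hs
  · linear_combination (-2 * t * sInv * (n - 1) + (n - 2) * t * sInv * (s * sInv + 1)) * hs

/-- For `n ≥ 2` no term is cut off and the recurrence gives zero; for `n < 0` all terms are cut off.
What remains is `c(0)` at `n = 0` and `c(1) - 2s c(0)` at `n = 1`. With `(c(0), c(1))` equal to `(1,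
0)` or `(0, 1)`, this is `1 - 2sτ` or `τ`. -/
theorem fundamentalSolution_nonneg_part (j : Fin 2) (n : ℤ) :
    (if n < 0 then 0 else fundamentalSolution j n) -
        2 * s * (if n - 1 < 0 then 0 else fundamentalSolution j (n - 1)) +
      s ^ 2 * (if n - 2 < 0 then 0 else fundamentalSolution j (n - 2)) = ECoeff j n := by
  rcases lt_trichotomy n 0 with h | rfl | h
  · simp [ECoeff, h, h.ne, show n - 1 < 0 by lia, show n - 2 < 0 by lia, show n ≠ 1 by lia]
  · simp [ECoeff, fundamentalSolution]
  · rcases (show 1 ≤ n from h).eq_or_lt with rfl | h'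
    · simp only [ECoeff, fundamentalSolution]
      split_ifs <;> simp_all
    · rw [if_neg (by lia), if_neg (by lia), if_neg (by lia), fundamentalSolution_rec]
      simp [ECoeff, h.ne', h'.ne']

/-- The negative half is the full series, which `e` annihilates, minus the nonnegative half. -/
theorem fundamentalSolution_neg_part (j : Fin 2) (n : ℤ) :
    (if n < 0 then fundamentalSolution j n else 0) -
        2 * s * (if n - 1 < 0 then fundamentalSolution j (n - 1) else 0) +
      s ^ 2 * (if n - 2 < 0 then fundamentalSolution j (n - 2) else 0) = -ECoeff j n := by
  have e : ∀ l, (if l < 0 then fundamentalSolution j l else 0) =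
      fundamentalSolution j l - if l < 0 then 0 else fundamentalSolution j l := fun l => by
    split_ifs <;> simp
  rw [e, e, e]
  linear_combination fundamentalSolution_rec j n - fundamentalSolution_nonneg_part j n

/-! ### Orthant parts of the generating series -/

theorem polyMul_dNumerator {m k : ℕ} (i : Fin k → Fin m) :
    polyMul (dNumerator i) (Pi.single 0 1) =
      ∑ j : Fin k → Fin 2, (dPoly i fun r => ((j r).val : ℤ)) • fun b => ∏ r, ECoeff (j r) (b r) := by
  simp only [dNumerator, polyMul_sum_left, polyMul_mul, polyMul_C, polyMul_smul_right,
    polyMul_prod_EPoly]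

/-- Membership in an orthant is a conjunction of conditions on single coordinates, so the cut-off
can be moved inside the product. -/
theorem orthantPart_dPoly {m k : ℕ} (i : Fin k → Fin m) (N : Finset (Fin k)) :
    orthantPart N (dPoly i) = ∑ j : Fin k → Fin 2, (dPoly i fun r => ((j r).val : ℤ)) • fun b =>
      ∏ r, if b r < 0 ↔ r ∈ N then fundamentalSolution (j r) (b r) else 0 := by
  ext1 b
  simp only [Finset.sum_apply, Pi.smul_apply, smul_eq_mul, Finset.prod_ite_zero, Finset.mem_univ,
    true_imp_iff, orthantPart]
  split_ifs
  · rw [dPoly_eq_sum]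
    exact Finset.sum_congr rfl fun _ _ => mul_comm _ _
  · simp

theorem polyMul_orthantPart_dPoly {m k : ℕ} (i : Fin k → Fin m) (N : Finset (Fin k)) :
    polyMul (∏ r, ePoly r) (orthantPart N (dPoly i)) =
      (-1 : Coeff) ^ N.card • polyMul (dNumerator i) (Pi.single 0 1) := by
  rw [orthantPart_dPoly, polyMul_dNumerator, polyMul_sum_right, Finset.smul_sum]
  refine Finset.sum_congr rfl fun j _ => ?_
  rw [polyMul_smul_right, smul_comm]
  congr 1
  -- A coordinate in `N` keeps the negative half and yields `-E_j`; any other keeps the nonnegative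
  -- half and yields `E_j`. The signs multiply to `(-1) ^ N.card`.
  rw [polyMul_prod_ePoly (h := fun r n => (if r ∈ N then -1 else 1) * ECoeff (j r) n)
    (g := fun r n => if n < 0 ↔ r ∈ N then fundamentalSolution (j r) n else 0) fun r n => ?_]
  · ext1 b
    simp only [Finset.prod_mul_distrib, Finset.prod_ite_mem, Finset.univ_inter, Finset.prod_const,
      Pi.smul_apply, smul_eq_mul]
  · by_cases hr : r ∈ N
    · simpa [hr] using fundamentalSolution_neg_part (j r) n
    · simpa only [hr, iff_false, ite_not, if_false, one_mul] using
        fundamentalSolution_nonneg_part (j r) n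

/-! ### Passage to power series -/

/-- The product of a polynomial and a power series, as a product of formal series over `ℤ^k`. -/
theorem coeff_coe_mul_eq_polyMul {k : ℕ} (p : MvPolynomial (Fin k) Coeff)
    (F : MvPowerSeries (Fin k) Coeff) {f : (Fin k → ℤ) → Coeff}
    (hf : ∀ a : Fin k →₀ ℕ, f (fun r => (a r : ℤ)) = MvPowerSeries.coeff a F)
    (hf' : ∀ a, (∃ r, a r < 0) → f a = 0) (b : Fin k →₀ ℕ) :
    MvPowerSeries.coeff b ((p : MvPowerSeries (Fin k) Coeff) * F) =
      polyMul p f fun r => (b r : ℤ) := by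
  induction p using MvPolynomial.induction_on' with
  | add p q hp hq =>
    rw [MvPolynomial.coe_add, add_mul, map_add, hp, hq, polyMul_add_left, Pi.add_apply]
  | monomial d c =>
    rw [MvPolynomial.coe_monomial, MvPowerSeries.coeff_monomial_mul, polyMul_monomial]
    split_ifs with h
    · rw [← hf]
      congr 2
      ext r
      rw [Finsupp.tsub_apply, Nat.cast_sub (h r)]
    -- If `d ≤ b` fails, the shifted exponent `b - d` has a negative coordinate, where `f` vanishes;
    -- the power series has no such term either.
    · rw [Finsupp.le_def, not_forall] at h
      obtain ⟨r, hr⟩ := h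
      rw [hf' _ ⟨r, by lia⟩, mul_zero]

/-- This is the orthant identity for `N = ∅`: the part with all exponents nonnegative is the power
series extended by zero. -/
theorem prod_ePoly_mul_dSeries {m k : ℕ} (i : Fin k → Fin m) :
    ((∏ r, ePoly r : MvPolynomial (Fin k) Coeff) : MvPowerSeries (Fin k) Coeff) * dSeries i =
      (dNumerator i : MvPowerSeries (Fin k) Coeff) := by
  ext b
  -- The comparison with series over `ℤ^k` is used on both sides; on the right, the numerator is
  -- regarded as its product with the power series `1`, whose extension by zero is `Pi.single 0 1`.
  rw [coeff_coe_mul_eq_polyMul _ _ (f := orthantPart ∅ (dPoly i)) (fun a => ?_) (fun a h => ?_),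
    polyMul_orthantPart_dPoly, Finset.card_empty, pow_zero, one_smul,
    ← coeff_coe_mul_eq_polyMul (dNumerator i) 1 (fun a => ?_) (fun a h => ?_), mul_one]
  · rw [MvPowerSeries.coeff_one, Pi.single_apply]
    simp only [funext_iff, Finsupp.ext_iff, Pi.zero_apply, Finsupp.zero_apply, Nat.cast_eq_zero]
  · obtain ⟨r, hr⟩ := h
    exact Pi.single_eq_of_ne (fun e => hr.ne (congrFun e r)) _
  · exact if_pos fun r => by simp
  · obtain ⟨r, hr⟩ := h
    exact if_neg fun e => Finset.notMem_empty r ((e r).1 hr)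

theorem prod_invOfUnit_mul_prod_ePoly {k : ℕ} :
    (∏ r, MvPowerSeries.invOfUnit ((ePoly r : MvPolynomial (Fin k) Coeff) :
        MvPowerSeries (Fin k) Coeff) 1) *
      ((∏ r, ePoly r : MvPolynomial (Fin k) Coeff) : MvPowerSeries (Fin k) Coeff) = 1 := by
  have h : ((∏ r, ePoly r : MvPolynomial (Fin k) Coeff) : MvPowerSeries (Fin k) Coeff) =
      ∏ r, ((ePoly r : MvPolynomial (Fin k) Coeff) : MvPowerSeries (Fin k) Coeff) :=
    map_prod MvPolynomial.coeToMvPowerSeries.ringHom _ _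
  rw [h, ← Finset.prod_mul_distrib]
  refine Finset.prod_eq_one fun r _ => ?_
  rw [mul_comm]
  -- `invOfUnit _ 1` is an inverse because `(1 - s t_r)²` has constant term `1`.
  refine MvPowerSeries.mul_invOfUnit _ _ ?_
  rw [← MvPowerSeries.coeff_zero_eq_constantCoeff_apply, MvPolynomial.coeff_coe,
    ← MvPolynomial.constantCoeff_eq]
  simp [ePoly]

end DegenerateLink

end

theorem theorem1p9 {m k : ℕ} (i : Fin k → Fin m) :
    dSeries i =
        (∏ r, MvPowerSeries.invOfUnit ((ePoly r : MvPolynomial (Fin k) Coeff) : MvPowerSeries (Fin k) Coeff) 1) *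
          (dNumerator i : MvPowerSeries (Fin k) Coeff) ∧
      ∀ N : Finset (Fin k),
        polyMul (∏ r, ePoly r) (orthantPart N (dPoly i)) =
          (-1 : Coeff) ^ N.card • polyMul (dNumerator i) (Pi.single 0 1) := by
  refine ⟨?_, polyMul_orthantPart_dPoly i⟩
  rw [← prod_ePoly_mul_dSeries, ← mul_assoc, prod_invOfUnit_mul_prod_ePoly, one_mul]
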